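/- For real $\nu,x\ge 0$ let $I_\nu(x)=\sum_{k\ge 0}\frac{1}{k!\,\Gamma(k+\nu+1)}\left(\frac x2\right)^{2k+\nu}$ be the modified Bessel function of the first kind and, for $x>0$, let $H(\nu,x)=\sum_{k\ge 1} I_{\nu+k}(x)/I_\nu(x)$. Let $[y]$ denote the floor of $y$ and $B$ the Beta function, and put $\alpha_0=-\log(\sqrt2-1)$ and $F(\nu,x)=\dfrac{x}{\nu+\sqrt{\nu^2+x^2}}$. Define $\mathcal L(0,x)$ and $\mathcal U(0,x)$ for $x>0$ as follows. If $[x]\ge 2$, $$\mathcal L(0,x)=\frac{2x\,e^{-1/x}}{\frac32+\sqrt{\frac94+4x}}-\frac{2x\,e^{-\frac{1}{2x}([x]+1)([x]+2)}}{[x]+\frac32+\sqrt{([x]+\frac32)^2+\frac{8x}{\pi}}}+e^{-\frac{([x]-1)[x]}{2x}}F([x],x)\bigl(1+F([x]+1,x)\bigr),$$ $$\mathcal U(0,x)=\frac{2x}{\alpha_0}\left[\frac{1}{\sqrt{\frac{8x}{\pi\alpha_0}}}-\frac{e^{-\frac{\alpha_0 x}{2}}}{x+\sqrt{x^2+\frac{4x}{\alpha_0}}}\right]+e^{-\frac{\alpha_0}{2x}([x]-1)^2}\,\frac{F([x]-\frac12,x)}{1-F([x]+\frac12,x)};$$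 if $[x]<2$, $$\mathcal L(0,x)=F(1,x)\bigl(1+F(2,x)\bigr),\qquad \mathcal U(0,x)=\frac{F(\frac12,x)}{1-F(\frac32,x)}.$$ Let $\lambda>0$, let $W\sim\mathrm{Skellam}(\lambda,\lambda)$, that is, $W$ has the law of $X_1-X_2$ for independent $\mathrm{Poisson}(\lambda)$ random variables $X_1,X_2$, and let $\nu\ge 0$ be an integer. 1. If $\nu\le 2\lambda$, then $$\frac{2\exp\left(-\frac{\nu(\nu+1)}{4\lambda}\right)}{1+2\,\mathcal U(0,2\lambda)}\le\frac{\mathbb P[|W|>\nu]}{H(\nu,2\lambda)}\le\frac{2\exp\left(-\frac{\alpha_0\nu^2}{4\lambda}\right)}{1+2\,\mathcal L(0,2\lambda)}.$$ 2. If $\nu>2\lambda$, then, with $m=[2\lambda]$, $$\frac{2\exp\left(-\frac{m(m+1)}{4\lambda}\right)B(m+\lambda+1,\nu-m)\,\frac{\lambda^{\nu-m}}{(\nu-m-1)!}}{1+2\,\mathcal U(0,2\lambda)}\le\frac{\mathbb P[|W|>\nu]}{H(\nu,2\lambda)}\le\frac{2\exp\left(-\frac{\alpha_0 m^2}{4\lambda}\right)B(m+2\lambda+\frac12,\nu-m)\,\frac{(2\lambda)^{\nu-m}}{(\nu-m-1)!}}{1+2\,\mathcal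 L(0,2\lambda)}.$$ -/

import Mathlib

namespace SkellamBounds

/-- The modified Bessel function of the first kind
`I_ν(x) = ∑_{k ≥ 0} (x / 2) ^ (2 k + ν) / (k! Γ(k + ν + 1))`, for real `ν, x ≥ 0`. -/
noncomputable def besselI (ν x : ℝ) : ℝ :=
  ∑' k : ℕ, 1 / ((k.factorial : ℝ) * Real.Gamma ((k : ℝ) + ν + 1)) *
    (x / 2) ^ (2 * (k : ℝ) + ν)

/-- `H(ν, x) = ∑_{k ≥ 1} I_{ν + k}(x) / I_ν(x)`. -/
noncomputable def H (ν x : ℝ) : ℝ :=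
  ∑' k : ℕ, besselI (ν + ((k : ℝ) + 1)) x / besselI ν x

/-- The constant `α₀ = -log (√2 - 1)`. -/
noncomputable def alpha0 : ℝ := -Real.log (Real.sqrt 2 - 1)

/-- `F(ν, x) = x / (ν + √(ν² + x²))`. -/
noncomputable def F (ν x : ℝ) : ℝ := x / (ν + Real.sqrt (ν ^ 2 + x ^ 2))

/-- The lower bound for `H(ν, x)` used when `[ν] + 2 ≤ [x]`; `Int.fract ν` is the fractional
part `ν_f` of `ν`. -/
noncomputable def gaussLower (ν x : ℝ) : ℝ :=
  2 * x * Real.exp (-(1 / x) * (ν + 1)) /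
      (ν + 3 / 2 + Real.sqrt ((ν + 3 / 2) ^ 2 + 4 * x))
    - 2 * x * Real.exp (-(1 / (2 * x)) * ((⌊x⌋ : ℝ) - ν - Int.fract ν + 1) *
          ((⌊x⌋ : ℝ) + ν - Int.fract ν + 2)) /
      ((⌊x⌋ : ℝ) + 3 / 2 + Real.sqrt (((⌊x⌋ : ℝ) + 3 / 2) ^ 2 + 8 * x / Real.pi))
    + Real.exp (-(((⌊x⌋ : ℝ) - (⌊ν⌋ : ℝ) - 1) * ((⌊x⌋ : ℝ) + ν + Int.fract ν)) / (2 * x)) *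
      (F ((⌊x⌋ : ℝ) + Int.fract ν) x * (1 + F ((⌊x⌋ : ℝ) + Int.fract ν + 1) x))

/-- The upper bound for `H(ν, x)` used when `[ν] + 2 ≤ [x]`. -/
noncomputable def gaussUpper (ν x : ℝ) : ℝ :=
  2 * x / alpha0 *
      (1 / (ν + Real.sqrt (ν ^ 2 + 8 * x / (Real.pi * alpha0)))
        - Real.exp (-(alpha0 / (2 * x)) * (x ^ 2 - ν ^ 2)) /
            (x + Real.sqrt (x ^ 2 + 4 * x / alpha0)))
    + Real.exp (-(alpha0 / (2 * x)) * ((⌊x⌋ : ℝ) - (⌊ν⌋ : ℝ) - 1) *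
          ((⌊x⌋ : ℝ) + ν + Int.fract ν - 1)) *
      (F ((⌊x⌋ : ℝ) + Int.fract ν - 1 / 2) x / (1 - F ((⌊x⌋ : ℝ) + Int.fract ν + 1 / 2) x))

/-- The lower bound for `H(ν, x)`: Gaussian type when `[ν] + 2 ≤ [x]`, geometric type when
`[ν] + 2 > [x]`. -/
noncomputable def lowerBound (ν x : ℝ) : ℝ :=
  if ⌊ν⌋ + 2 ≤ ⌊x⌋ then gaussLower ν x else F (ν + 1) x * (1 + F (ν + 2) x)

/-- The upper bound for `H(ν, x)`: Gaussian type when `[ν] + 2 ≤ [x]`, geometric type when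
`[ν] + 2 > [x]`. -/
noncomputable def upperBound (ν x : ℝ) : ℝ :=
  if ⌊ν⌋ + 2 ≤ ⌊x⌋ then gaussUpper ν x else F (ν + 1 / 2) x / (1 - F (ν + 3 / 2) x)

/-- The Skellam distribution: the law of `X₁ - X₂` for independent Poisson variables `X₁`, `X₂`
with parameters `l₁`, `l₂`. -/
noncomputable def skellam (l₁ l₂ : NNReal) : MeasureTheory.Measure ℤ :=
  ((ProbabilityTheory.poissonMeasure l₁).prod (ProbabilityTheory.poissonMeasure l₂)).map
    (fun p : ℕ × ℕ => (p.1 : ℤ) - (p.2 : ℤ))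

end SkellamBounds

namespace SkellamBounds

/-! With x = 2λ, summing the Poisson product law along diagonals gives P[W = ±n] = e^{-x} I_n(x).
The tail beyond ν is therefore 2 e^{-x} I_ν(x) H(ν, x), and total mass one reads e^{-x} I_0(x) (1 +
2 H(0, x)) = 1. Dividing, P[|W| > ν] / H(ν, x) = 2 (I_ν / I_0) / (1 + 2 H(0, x)) exactly
(`skellam_tail_div_H`), so it remains to bound I_ν / I_0 and H(0, x) on both sides.

Both reduce to the ratios r_n = I_{n+1} / I_n, which satisfy F(n + 1, x) ≤ r_n ≤ F(n + 1/2, x)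
(`F_le_besselRatio`, `besselRatio_le_F`). Since F(a, x) = exp(-arsinh(a/x)), the bounds arsinh t ≤ t
for t ≥ 0 and arsinh t ≥ α₀ t on [0, 1] turn the product of the r_n into Gaussian factors. Beyond
index [x] the upper Gaussian bound is replaced, as is the lower one, by rational bounds on F whose
products are Beta functions.

For H(0, x), the sum of I_k / I_0, the Gaussian bounds are summed up to about [x] and compared with
a Gaussian integral through the Mills-type function `millsLower`, whose unit decrements are
dominated by the Gaussian terms. The rest is a geometric series above (`H_zero_le_upperBound`) and
finitely many explicit terms below (`lowerBound_zero_le_H`). -/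

/-! ### Bessel series of integer order: recurrence, products, Turán-type inequalities. -/

/-- The series `∑ t ^ (2 k + n) / (k! (k + n)!)`, which is `I_n (2 t)`. -/
noncomputable def besselSeries (n : ℕ) (t : ℝ) : ℝ :=
  ∑' k : ℕ, t ^ (2 * k + n) / ((k.factorial : ℝ) * ((k + n).factorial : ℝ))

theorem besselSeries_term_nonneg (n k : ℕ) {t : ℝ} (ht : 0 ≤ t) :
    0 ≤ t ^ (2 * k + n) / ((k.factorial : ℝ) * ((k + n).factorial : ℝ)) := by positivity

theorem summable_besselSeries (n : ℕ) {t : ℝ} (ht : 0 ≤ t) :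
    Summable fun k : ℕ => t ^ (2 * k + n) / ((k.factorial : ℝ) * ((k + n).factorial : ℝ)) := by
  refine Summable.of_nonneg_of_le (fun k => besselSeries_term_nonneg n k ht) (fun k => ?_)
    ((Real.summable_pow_div_factorial (t ^ 2)).mul_left (t ^ n))
  rw [pow_add, pow_mul, mul_comm, ← mul_div_assoc]
  apply div_le_div_of_nonneg_left (by positivity) (by positivity)
  have : (1 : ℝ) ≤ ((k + n).factorial : ℝ) := by exact_mod_cast Nat.factorial_pos _
  exact le_mul_of_one_le_right (by positivity) this

theorem besselSeries_pos (n : ℕ) {t : ℝ} (ht : 0 < t) : 0 < besselSeries n t :=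
  (summable_besselSeries n ht.le).tsum_pos (fun k => besselSeries_term_nonneg n k ht.le) 0
    (by positivity)

theorem besselI_natCast (n : ℕ) (x : ℝ) :
    besselI (n : ℝ) x = besselSeries n (x / 2) := by
  unfold besselI besselSeries
  congr 1; ext k
  have h1 : Real.Gamma ((k : ℝ) + n + 1) = ((k + n).factorial : ℝ) := by
    rw [← Nat.cast_add, Real.Gamma_nat_eq_factorial]
  have h2 : (x / 2) ^ (2 * (k : ℝ) + n) = (x / 2) ^ (2 * k + n) := by
    rw [← Real.rpow_natCast]; push_cast; rfl
  rw [h1, h2]; ring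

theorem besselSeries_recurrence (n : ℕ) {t : ℝ} (ht : 0 ≤ t) :
    ((n : ℝ) + 1) * besselSeries (n + 1) t
      = t * (besselSeries n t - besselSeries (n + 2) t) := by
  have h0 := summable_besselSeries n ht
  have h2 := summable_besselSeries (n + 2) ht
  have h1 := summable_besselSeries (n + 1) ht
  unfold besselSeries
  rw [h0.tsum_eq_zero_add, h1.tsum_eq_zero_add, add_sub_assoc, mul_add, mul_add,
    ← ((summable_nat_add_iff 1).2 h0).tsum_sub h2, ← tsum_mul_left, ← tsum_mul_left]
  congr 1
  · simp only [zero_add, Nat.factorial_succ, mul_zero, pow_succ]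
    have := n.factorial_pos
    push_cast
    field_simp
  · congr 1; ext k
    have e1 : k + 1 + (n + 1) = (k + n + 1) + 1 := by ring
    have e2 : k + (n + 2) = (k + n + 1) + 1 := by ring
    have e3 : k + 1 + n = k + n + 1 := by ring
    rw [e1, e2, e3, Nat.factorial_succ k, Nat.factorial_succ (k + n + 1)]
    have := k.factorial_pos
    have := (k + n + 1).factorial_pos
    push_cast
    field_simp
    ring

/-- Vandermonde's identity for (k + n) + (k + m) choose k. The factorials (k + n)! and (k + m)!
cancel, leaving the Cauchy product of two Bessel series in closed form. -/
theorem sum_antidiagonal_besselSeries_term (m n k : ℕ) (t : ℝ) :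
    ((2 * k + m + n).choose k : ℝ) * t ^ (2 * k + m + n) /
        (((k + m).factorial : ℝ) * ((k + n).factorial : ℝ)) =
      ∑ p ∈ Finset.HasAntidiagonal.antidiagonal k,
        t ^ (2 * p.1 + m) / ((p.1.factorial : ℝ) * ((p.1 + m).factorial : ℝ)) *
          (t ^ (2 * p.2 + n) / ((p.2.factorial : ℝ) * ((p.2 + n).factorial : ℝ))) := by
  have hc : ((2 * k + m + n).choose k : ℝ) =
      ∑ p ∈ Finset.HasAntidiagonal.antidiagonal k, ((k + n).choose p.1 : ℝ) * ((k + m).choose p.2 : ℝ) := by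
    have := Nat.add_choose_eq (k + n) (k + m) k
    rw [show 2 * k + m + n = k + n + (k + m) by ring, this]
    exact_mod_cast rfl
  rw [hc, Finset.sum_mul, Finset.sum_div]
  refine Finset.sum_congr rfl fun p hp => ?_
  obtain ⟨i, j⟩ := p
  simp only [Finset.HasAntidiagonal.mem_antidiagonal] at hp
  subst hp
  dsimp only
  rw [show i + j + n = i + (j + n) by ring, show i + j + m = j + (i + m) by ring,
    Nat.cast_add_choose, Nat.cast_add_choose,
    show t ^ (2 * (i + j) + m + n) = t ^ (2 * i + m) * t ^ (2 * j + n) by rw [← pow_add]; congr 1; ring]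
  have h1 : ((i + (j + n)).factorial : ℝ) ≠ 0 := by positivity
  have h2 : ((j + (i + m)).factorial : ℝ) ≠ 0 := by positivity
  have h3 : (i.factorial : ℝ) ≠ 0 := by positivity
  have h4 : (j.factorial : ℝ) ≠ 0 := by positivity
  have h5 : ((j + n).factorial : ℝ) ≠ 0 := by positivity
  have h6 : ((i + m).factorial : ℝ) ≠ 0 := by positivity
  generalize ((i + (j + n)).factorial : ℝ) = a at *
  generalize ((j + (i + m)).factorial : ℝ) = b at *
  generalize (i.factorial : ℝ) = c at *
  generalize (j.factorial : ℝ) = d at *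
  generalize ((j + n).factorial : ℝ) = e at *
  generalize ((i + m).factorial : ℝ) = f at *
  generalize t ^ (2 * i + m) = u
  generalize t ^ (2 * j + n) = v
  clear hc
  field_simp

theorem hasSum_cauchyProduct {f g : ℕ → ℝ} (hf : Summable f) (hg : Summable g)
    (hf0 : ∀ k, 0 ≤ f k) (hg0 : ∀ k, 0 ≤ g k) :
    HasSum (fun k => ∑ p ∈ Finset.HasAntidiagonal.antidiagonal k, f p.1 * g p.2)
      ((∑' k, f k) * ∑' k, g k) := by
  have hs := hf.mul_of_nonneg hg hf0 hg0
  rw [hf.tsum_mul_tsum_eq_tsum_sum_antidiagonal hg hs]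
  exact (summable_sum_mul_antidiagonal_of_summable_mul hs).hasSum

theorem besselSeries_mul (m n : ℕ) {t : ℝ} (ht : 0 ≤ t) :
    HasSum (fun k : ℕ => ((2 * k + m + n).choose k : ℝ) * t ^ (2 * k + m + n) /
        (((k + m).factorial : ℝ) * ((k + n).factorial : ℝ)))
      (besselSeries m t * besselSeries n t) := by
  rw [funext fun k => sum_antidiagonal_besselSeries_term m n k t]
  unfold besselSeries
  exact hasSum_cauchyProduct
    (f := fun k => t ^ (2 * k + m) / ((k.factorial : ℝ) * ((k + m).factorial : ℝ)))
    (g := fun k => t ^ (2 * k + n) / ((k.factorial : ℝ) * ((k + n).factorial : ℝ)))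
    (summable_besselSeries m ht) (summable_besselSeries n ht)
    (fun k => besselSeries_term_nonneg m k ht) (fun k => besselSeries_term_nonneg n k ht)

/-- Log-concavity of the order. -/
theorem besselSeries_mul_le_sq (n : ℕ) {t : ℝ} (ht : 0 ≤ t) :
    besselSeries n t * besselSeries (n + 2) t ≤ besselSeries (n + 1) t ^ 2 := by
  rw [pow_two]
  refine hasSum_le (fun k => ?_) (besselSeries_mul n (n + 2) ht)
    (besselSeries_mul (n + 1) (n + 1) ht)
  -- The numerators now agree, so only (k + n + 1)!² ≤ (k + n)! (k + n + 2)! is left.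
  rw [show 2 * k + n + (n + 2) = 2 * k + (n + 1) + (n + 1) by ring]
  apply div_le_div_of_nonneg_left (by positivity) (by positivity)
  rw [show k + (n + 2) = (k + n + 1) + 1 by ring, show k + (n + 1) = (k + n) + 1 by ring,
    Nat.factorial_succ (k + n + 1), Nat.factorial_succ (k + n)]
  have := (k + n).factorial_pos
  push_cast
  have h : (0 : ℝ) < ((k + n).factorial : ℝ) := by exact_mod_cast this
  have : (0 : ℝ) ≤ ((k + n).factorial : ℝ) ^ 2 * ((k : ℝ) + n + 1) := by positivity
  nlinarith

theorem choose_term_identity (N k : ℕ) :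
    ((N + 1 : ℕ) : ℝ) * (((N : ℕ).choose (k + 1) : ℝ) - (N.choose k : ℝ))
      = ((N : ℝ) + 1 - 2 * (k + 1)) * ((N + 1).choose (k + 1) : ℝ) := by
  have h1 : ((N + 1 : ℕ) : ℝ) * (N.choose k : ℝ) = ((N + 1).choose (k + 1) : ℝ) * ((k : ℝ) + 1) := by
    exact_mod_cast Nat.add_one_mul_choose_eq N k
  have h2 : ((N + 1).choose (k + 1) : ℝ) = (N.choose k : ℝ) + (N.choose (k + 1) : ℝ) := by
    exact_mod_cast Nat.choose_succ_succ N k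
  have h3 : (N.choose (k + 1) : ℝ) = ((N + 1).choose (k + 1) : ℝ) - (N.choose k : ℝ) := by
    linarith
  rw [h3]
  push_cast at h1 ⊢
  linarith

/-- Coefficientwise comparison of Cauchy products. After division by I_n² this is x r² + (2n + 1) r
≤ x for r = I_{n+1} / I_n and x = 2t, the quadratic inequality behind r ≤ F(n + 1/2, x). -/
theorem besselSeries_turan_antitone (n : ℕ) {t : ℝ} (ht : 0 ≤ t) :
    ((n : ℝ) + 1 / 2) * (besselSeries n t * besselSeries (n + 1) t)
      ≤ t * (besselSeries n t ^ 2 - besselSeries (n + 1) t ^ 2) := by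
  have hA := besselSeries_mul n (n + 1) ht
  have hB := besselSeries_mul n n ht
  have hC := besselSeries_mul (n + 1) (n + 1) ht
  -- Dropping the zeroth term of I_n² and of I_n I_{n+1} aligns the powers of t with those of
  -- I_{n+1}²; the dropped terms are compared in `h0`.
  have hB' := (hasSum_nat_add_iff' 1).2 hB
  have hA' := (hasSum_nat_add_iff' 1).2 hA
  simp only [Finset.sum_range_one] at hB' hA'
  have key := hasSum_le (fun k => ?_) (hA'.mul_left ((n : ℝ) + 1 / 2))
    ((hB'.sub hC).mul_left t)
  · have h0 : ((n : ℝ) + 1 / 2) * (((2 * 0 + n + (n + 1)).choose 0 : ℝ) * t ^ (2 * 0 + n + (n + 1)) /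
        (((0 + n).factorial : ℝ) * ((0 + (n + 1)).factorial : ℝ))) ≤
        t * (((2 * 0 + n + n).choose 0 : ℝ) * t ^ (2 * 0 + n + n) /
        (((0 + n).factorial : ℝ) * ((0 + n).factorial : ℝ))) := by
      simp only [Nat.choose_zero_right, mul_zero, zero_add, Nat.factorial_succ]
      have h := n.factorial_pos
      have h' : (0 : ℝ) < n.factorial := by exact_mod_cast h
      have e : t * (((1 : ℕ) : ℝ) * t ^ (n + n) / ((n.factorial : ℝ) * n.factorial)) -
        ((n : ℝ) + 1 / 2) * (((1 : ℕ) : ℝ) * t ^ (n + (n + 1)) /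
          ((n.factorial : ℝ) * (((n + 1) * n.factorial : ℕ) : ℝ))) =
          t ^ (n + n + 1) / (2 * (n + 1) * n.factorial ^ 2) := by
        push_cast
        field_simp
        ring
      have : 0 ≤ t ^ (n + n + 1) / (2 * (n + 1) * (n.factorial : ℝ) ^ 2) := by positivity
      linarith
    nlinarith [key, h0]
  · have e1 : 2 * (k + 1) + n + (n + 1) = (2 * k + (n + 1) + (n + 1)) + 1 := by ring
    have e2 : 2 * (k + 1) + n + n = 2 * k + (n + 1) + (n + 1) := by ring
    have hch := choose_term_identity (2 * k + (n + 1) + (n + 1)) k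
    rw [e1, e2, show k + 1 + n = k + (n + 1) by ring,
      show k + 1 + (n + 1) = (k + (n + 1)) + 1 by ring, Nat.factorial_succ (k + (n + 1)),
      pow_succ]
    have hf : (0 : ℝ) < ((k + (n + 1)).factorial : ℝ) := by
      exact_mod_cast Nat.factorial_pos _
    set N := 2 * k + (n + 1) + (n + 1) with hN
    set f : ℝ := ((k + (n + 1)).factorial : ℝ)
    set C : ℝ := ((N + 1).choose (k + 1) : ℝ) with hC'
    have hCnn : 0 ≤ C := by positivity
    have hNr : (N : ℝ) = 2 * k + 2 * n + 2 := by rw [hN]; push_cast; ring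
    have hd : ((N.choose (k + 1) : ℕ) : ℝ) - (N.choose k : ℝ) = (2 * n + 1) * C / (N + 1) := by
      rw [eq_div_iff (by positivity)]
      push_cast at hch
      rw [hNr] at hch ⊢
      linarith
    have e3 : t * (((N.choose (k + 1) : ℕ) : ℝ) * t ^ N / (f * f) - (N.choose k : ℝ) * t ^ N / (f * f))
        = t * t ^ N / (f * f) * ((2 * n + 1) * C / (N + 1)) := by
      rw [← hd]; ring
    rw [e3, hNr]
    -- The coefficients differ only through 1/(2k + 2n + 3) against 1/(2k + 2n + 4).
    have e4 : t * t ^ N / (f * f) * ((2 * n + 1) * C / (2 * k + 2 * n + 2 + 1)) -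
        ((n : ℝ) + 1 / 2) * (C * (t ^ N * t) / (f * (((k + (n + 1) + 1 : ℕ) : ℝ) * f))) =
        t * t ^ N / (f * f) * C * (n + 1 / 2) *
          (1 / ((2 * k + 2 * n + 2 + 1) * (k + n + 2))) := by
      push_cast
      field_simp
      ring
    have : 0 ≤ t * t ^ N / (f * f) * C * (n + 1 / 2) *
          (1 / ((2 * k + 2 * n + 2 + 1) * (k + n + 2) : ℝ)) := by positivity
    push_cast at e4 ⊢
    linarith

/-! ### Bounds on consecutive ratios by F, and on F by exponentials and fractions. -/

/-- The ratio `I_{n+1}(x) / I_n(x)`. -/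
noncomputable def besselRatio (n : ℕ) (x : ℝ) : ℝ :=
  besselSeries (n + 1) (x / 2) / besselSeries n (x / 2)

theorem besselRatio_pos (n : ℕ) {x : ℝ} (hx : 0 < x) : 0 < besselRatio n x :=
  div_pos (besselSeries_pos _ (by positivity)) (besselSeries_pos _ (by positivity))

theorem besselRatio_succ_le (n : ℕ) {x : ℝ} (hx : 0 < x) :
    besselRatio (n + 1) x ≤ besselRatio n x := by
  have h := besselSeries_mul_le_sq n (t := x / 2) (by positivity)
  have h0 := besselSeries_pos n (t := x / 2) (by positivity)
  have h1 := besselSeries_pos (n + 1) (t := x / 2) (by positivity)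
  unfold besselRatio
  rw [div_le_div_iff₀ h1 h0, ← pow_two, mul_comm]
  exact h

theorem besselRatio_antitone {x : ℝ} (hx : 0 < x) : Antitone fun n => besselRatio n x :=
  antitone_nat_of_succ_le fun n => besselRatio_succ_le n hx

theorem F_pos {a x : ℝ} (ha : 0 ≤ a) (hx : 0 < x) : 0 < F a x := by
  unfold F; positivity

/-- F(a, x) is the positive root of x r² + 2 a r = x, so comparing a ratio with F amounts to the
sign of this quadratic. -/
theorem F_quadratic {a x : ℝ} (ha : 0 ≤ a) (hx : 0 < x) :
    x * F a x ^ 2 + 2 * a * F a x = x := by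
  have hs := Real.sq_sqrt (show 0 ≤ a ^ 2 + x ^ 2 by positivity)
  have hs0 : 0 < Real.sqrt (a ^ 2 + x ^ 2) := by positivity
  unfold F
  set s := Real.sqrt (a ^ 2 + x ^ 2)
  have : a + s ≠ 0 := by positivity
  field_simp
  nlinarith

theorem F_le_of_le_quadratic {a x r : ℝ} (ha : 0 ≤ a) (hx : 0 < x) (hr : 0 ≤ r)
    (h : x ≤ x * r ^ 2 + 2 * a * r) : F a x ≤ r := by
  have hq := F_quadratic ha hx
  have hp := F_pos ha hx
  by_contra! hlt
  nlinarith [mul_pos hx (mul_pos hp (sub_pos.2 hlt)), mul_nonneg ha (sub_pos.2 hlt).le,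
    mul_nonneg hx.le (mul_nonneg hr (sub_pos.2 hlt).le)]

theorem le_F_of_quadratic_le {a x r : ℝ} (ha : 0 ≤ a) (hx : 0 < x) (hr : 0 ≤ r)
    (h : x * r ^ 2 + 2 * a * r ≤ x) : r ≤ F a x := by
  have hq := F_quadratic ha hx
  have hp := F_pos ha hx
  by_contra! hlt
  nlinarith [mul_pos hx (mul_pos hp (sub_pos.2 hlt)), mul_nonneg ha (sub_pos.2 hlt).le,
    mul_nonneg hx.le (mul_nonneg hr (sub_pos.2 hlt).le)]

/-- The recurrence eliminates I_{n+2} from the log-concavity inequality, which becomes the quadratic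
inequality with a = n + 1. -/
theorem F_le_besselRatio (n : ℕ) {x : ℝ} (hx : 0 < x) : F (n + 1) x ≤ besselRatio n x := by
  have h0 := besselSeries_pos n (t := x / 2) (by positivity)
  have h1 := besselSeries_pos (n + 1) (t := x / 2) (by positivity)
  have hrec := besselSeries_recurrence n (t := x / 2) (by positivity)
  have hle := besselSeries_mul_le_sq n (t := x / 2) (by positivity)
  refine F_le_of_le_quadratic (by positivity) hx (besselRatio_pos n hx).le ?_
  unfold besselRatio
  set a := besselSeries n (x / 2)
  set b := besselSeries (n + 1) (x / 2)
  set c := besselSeries (n + 2) (x / 2)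
  have : x * (b / a) ^ 2 + 2 * ((n : ℝ) + 1) * (b / a) - x = x * (b ^ 2 - a * c) / a ^ 2 := by
    field_simp
    linear_combination 2 * a * hrec
  have : 0 ≤ x * (b ^ 2 - a * c) / a ^ 2 := by
    have := sub_nonneg.2 hle
    positivity
  linarith

theorem besselRatio_le_F (n : ℕ) {x : ℝ} (hx : 0 < x) : besselRatio n x ≤ F (n + 1 / 2) x := by
  have h0 := besselSeries_pos n (t := x / 2) (by positivity)
  have hle := besselSeries_turan_antitone n (t := x / 2) (by positivity)
  refine le_F_of_quadratic_le (by positivity) hx (besselRatio_pos n hx).le ?_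
  unfold besselRatio
  set a := besselSeries n (x / 2)
  set b := besselSeries (n + 1) (x / 2)
  rw [← sub_nonneg]
  have : x - (x * (b / a) ^ 2 + 2 * ((n : ℝ) + 1 / 2) * (b / a))
      = 2 * (x / 2 * (a ^ 2 - b ^ 2) - ((n : ℝ) + 1 / 2) * (a * b)) / a ^ 2 := by
    field_simp
    ring
  rw [this]
  have := sub_nonneg.2 hle
  positivity

theorem F_eq_exp {a x : ℝ} (ha : 0 ≤ a) (hx : 0 < x) : F a x = Real.exp (-Real.arsinh (a / x)) := by
  rw [Real.exp_neg, Real.exp_arsinh, F]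
  have : Real.sqrt (1 + (a / x) ^ 2) = Real.sqrt (a ^ 2 + x ^ 2) / x := by
    rw [show 1 + (a / x) ^ 2 = (a ^ 2 + x ^ 2) / x ^ 2 by field_simp; ring,
      Real.sqrt_div (by positivity), Real.sqrt_sq hx.le]
  rw [this]
  field_simp

theorem exp_le_F {a x : ℝ} (ha : 0 ≤ a) (hx : 0 < x) : Real.exp (-(a / x)) ≤ F a x := by
  rw [F_eq_exp ha hx, Real.exp_le_exp, neg_le_neg_iff, ← Real.sinh_le_sinh, Real.sinh_arsinh]
  exact Real.self_le_sinh_iff.2 (by positivity)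

theorem alpha0_eq_arsinh : alpha0 = Real.arsinh 1 := by
  have h2 : Real.sqrt 2 ^ 2 = 2 := Real.sq_sqrt (by norm_num)
  have h1 : 1 < Real.sqrt 2 := by
    rw [Real.lt_sqrt] <;> norm_num
  unfold alpha0 Real.arsinh
  rw [← Real.log_inv]
  congr 1
  rw [one_pow, one_add_one_eq_two, inv_eq_iff_eq_inv]
  refine eq_inv_of_mul_eq_one_left ?_
  nlinarith

theorem alpha0_pos : 0 < alpha0 := by
  rw [alpha0_eq_arsinh]; exact Real.arsinh_pos_iff.2 one_pos

theorem convexOn_sinh : ConvexOn ℝ (Set.Ici 0) Real.sinh := by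
  apply MonotoneOn.convexOn_of_deriv (convex_Ici 0) Real.continuous_sinh.continuousOn
    Real.differentiable_sinh.differentiableOn
  rw [interior_Ici, Real.deriv_sinh]
  intro a ha b hb hab
  rw [Real.cosh_le_cosh, abs_of_pos ha, abs_of_pos hb]
  exact hab

/-- As α₀ = arsinh 1, convexity puts sinh below its chord on [0, α₀]: sinh(α₀ t) ≤ t. -/
theorem alpha0_mul_le_arsinh {t : ℝ} (h0 : 0 ≤ t) (h1 : t ≤ 1) : alpha0 * t ≤ Real.arsinh t := by
  rw [← Real.sinh_le_sinh, Real.sinh_arsinh]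
  have := convexOn_sinh.2 (Set.self_mem_Ici (a := (0 : ℝ))) (show alpha0 ∈ Set.Ici 0 from alpha0_pos.le)
    (sub_nonneg.2 h1) h0 (sub_add_cancel 1 t)
  simp only [smul_eq_mul, mul_zero, zero_add, Real.sinh_zero] at this
  rw [alpha0_eq_arsinh, Real.sinh_arsinh] at this
  rw [alpha0_eq_arsinh, mul_comm]
  linarith

theorem F_le_exp {a x : ℝ} (ha : 0 ≤ a) (hx : 0 < x) (hax : a ≤ x) :
    F a x ≤ Real.exp (-(alpha0 * (a / x))) := by
  rw [F_eq_exp ha hx, Real.exp_le_exp, neg_le_neg_iff]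
  exact alpha0_mul_le_arsinh (by positivity) ((div_le_one hx).2 hax)

theorem F_lt_one {a x : ℝ} (ha : 0 < a) (hx : 0 < x) : F a x < 1 := by
  rw [F_eq_exp ha.le hx, Real.exp_lt_one_iff, neg_lt_zero, Real.arsinh_pos_iff]
  positivity

theorem div_add_le_F {a x : ℝ} (ha : 0 ≤ a) (hx : 0 < x) : x / 2 / (a + x / 2) ≤ F a x := by
  have h : Real.sqrt (a ^ 2 + x ^ 2) ≤ a + x := by
    rw [Real.sqrt_le_left (by positivity)]; nlinarith [mul_nonneg ha hx.le]
  unfold F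
  rw [div_div, mul_add]
  apply div_le_div_of_nonneg_left hx.le (by positivity)
  linarith

theorem F_le_div_add {a x : ℝ} (ha : 0 ≤ a) (hx : 0 < x) : F a x ≤ x / (a + x) := by
  have h : x ≤ Real.sqrt (a ^ 2 + x ^ 2) := Real.le_sqrt_of_sq_le (by nlinarith)
  unfold F
  gcongr

/-! ### Gaussian and Beta-function bounds for I_n / I_0. -/

/-- `I_n(x) / I_0(x)`. -/
noncomputable def besselQuot (n : ℕ) (x : ℝ) : ℝ :=
  besselSeries n (x / 2) / besselSeries 0 (x / 2)

theorem besselQuot_zero {x : ℝ} (hx : 0 < x) : besselQuot 0 x = 1 :=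
  div_self (besselSeries_pos 0 (by positivity)).ne'

theorem besselQuot_pos (n : ℕ) {x : ℝ} (hx : 0 < x) : 0 < besselQuot n x :=
  div_pos (besselSeries_pos _ (by positivity)) (besselSeries_pos _ (by positivity))

theorem besselQuot_succ (n : ℕ) {x : ℝ} (hx : 0 < x) :
    besselQuot (n + 1) x = besselQuot n x * besselRatio n x := by
  have h0 := besselSeries_pos n (t := x / 2) (by positivity)
  have h1 := besselSeries_pos 0 (t := x / 2) (by positivity)
  unfold besselQuot besselRatio
  field_simp

theorem exp_le_besselQuot (n : ℕ) {x : ℝ} (hx : 0 < x) :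
    Real.exp (-((n : ℝ) * (n + 1) / (2 * x))) ≤ besselQuot n x := by
  induction n with
  | zero => simp [besselQuot_zero hx]
  | succ n ih =>
    rw [besselQuot_succ n hx]
    have h := (exp_le_F (a := (n : ℝ) + 1) (by positivity) hx).trans (F_le_besselRatio n hx)
    refine le_trans (le_of_eq ?_) (mul_le_mul ih h (Real.exp_nonneg _) (besselQuot_pos n hx).le)
    -- The exponents add up through 1 + ... + n = n(n + 1)/2; in `besselQuot_le_exp` the
    -- half-integers 1/2, 3/2, ... sum to n²/2.
    rw [← Real.exp_add]
    congr 1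
    push_cast
    field_simp
    ring

theorem besselQuot_le_exp (n : ℕ) {x : ℝ} (hx : 0 < x) (hn : (n : ℝ) ≤ x) :
    besselQuot n x ≤ Real.exp (-(alpha0 * (n : ℝ) ^ 2 / (2 * x))) := by
  induction n with
  | zero => simp [besselQuot_zero hx]
  | succ n ih =>
    push_cast at hn
    rw [besselQuot_succ n hx]
    have h := (besselRatio_le_F n hx).trans
      (F_le_exp (a := (n : ℝ) + 1 / 2) (by positivity) hx (by linarith))
    refine le_trans (mul_le_mul (ih (by linarith)) h (besselRatio_pos n hx).le (Real.exp_nonneg _))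
      (le_of_eq ?_)
    rw [← Real.exp_add]
    congr 1
    push_cast
    field_simp
    ring

theorem beta_mul_pow_div_factorial_zero {a y : ℝ} (ha : 0 < a) :
    ProbabilityTheory.beta a ((0 : ℕ) + 1 : ℝ) * (y ^ (0 + 1) / (Nat.factorial 0 : ℝ)) = y / a := by
  unfold ProbabilityTheory.beta
  have := (Real.Gamma_pos_of_pos ha).ne'
  simp only [Nat.cast_zero, zero_add, Real.Gamma_one, Real.Gamma_add_one ha.ne', pow_one,
    Nat.factorial_zero, Nat.cast_one]
  field_simp

/-- Inductive step of B(a, k + 1) y^{k+1} / k! = ∏_{j ≤ k} y / (a + j), the form taken by products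
of the rational bounds on F. -/
theorem beta_mul_pow_div_factorial_succ {a y : ℝ} (ha : 0 < a) (k : ℕ) :
    ProbabilityTheory.beta a ((k + 1 : ℕ) + 1 : ℝ) * (y ^ (k + 1 + 1) / (Nat.factorial (k + 1) : ℝ)) =
      ProbabilityTheory.beta a ((k : ℕ) + 1 : ℝ) * (y ^ (k + 1) / (Nat.factorial k : ℝ)) *
        (y / (a + (k + 1))) := by
  unfold ProbabilityTheory.beta
  have h1 : Real.Gamma (((k + 1 : ℕ) : ℝ) + 1) = (k + 1) * Real.Gamma ((k : ℝ) + 1) := by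
    rw [Real.Gamma_add_one (by positivity)]; push_cast; rfl
  have h2 : Real.Gamma (a + (((k + 1 : ℕ) : ℝ) + 1)) =
      (a + (k + 1)) * Real.Gamma (a + ((k : ℝ) + 1)) := by
    rw [← Real.Gamma_add_one (by positivity)]; push_cast; congr 1; ring
  have h3 : Real.Gamma (a + ((k : ℝ) + 1)) ≠ 0 := (Real.Gamma_pos_of_pos (by positivity)).ne'
  have h4 : (k.factorial : ℝ) ≠ 0 := by positivity
  have h5 : a + ((k : ℝ) + 1) ≠ 0 := by positivity
  rw [h1, h2, Nat.factorial_succ]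
  push_cast
  field_simp
  ring

theorem le_besselQuot_add (m k : ℕ) {x : ℝ} (hx : 0 < x) :
    besselQuot m x * (ProbabilityTheory.beta ((m : ℝ) + x / 2 + 1) ((k : ℝ) + 1) *
      ((x / 2) ^ (k + 1) / (k.factorial : ℝ))) ≤ besselQuot (m + (k + 1)) x := by
  induction k with
  | zero =>
    rw [beta_mul_pow_div_factorial_zero (by positivity), ← add_assoc m, add_zero,
      besselQuot_succ m hx]
    refine mul_le_mul_of_nonneg_left ?_ (besselQuot_pos m hx).le
    refine le_trans (le_of_eq ?_) ((div_add_le_F (a := (m : ℝ) + 1) (by positivity) hx).trans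
      (F_le_besselRatio m hx))
    congr 1; ring
  | succ k ih =>
    rw [beta_mul_pow_div_factorial_succ (by positivity), ← mul_assoc, ← add_assoc m,
      besselQuot_succ _ hx]
    refine mul_le_mul ih ?_ (by positivity) (besselQuot_pos _ hx).le
    refine le_trans (le_of_eq ?_) ((div_add_le_F (a := ((m + (k + 1) : ℕ) : ℝ) + 1)
      (by positivity) hx).trans (F_le_besselRatio _ hx))
    congr 1; push_cast; ring

theorem besselQuot_add_le (m k : ℕ) {x : ℝ} (hx : 0 < x) :
    besselQuot (m + (k + 1)) x ≤
    besselQuot m x * (ProbabilityTheory.beta ((m : ℝ) + x + 1 / 2) ((k : ℝ) + 1) *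
      (x ^ (k + 1) / (k.factorial : ℝ))) := by
  induction k with
  | zero =>
    rw [beta_mul_pow_div_factorial_zero (by positivity), ← add_assoc m, add_zero,
      besselQuot_succ m hx]
    refine mul_le_mul_of_nonneg_left ?_ (besselQuot_pos m hx).le
    refine ((besselRatio_le_F m hx).trans (F_le_div_add (a := (m : ℝ) + 1 / 2)
      (by positivity) hx)).trans (le_of_eq ?_)
    congr 1; ring
  | succ k ih =>
    rw [beta_mul_pow_div_factorial_succ (by positivity), ← mul_assoc, ← add_assoc m,
      besselQuot_succ _ hx]
    refine mul_le_mul ih ?_ (besselRatio_pos _ hx).le ((besselQuot_pos _ hx).le.trans ih)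
    refine ((besselRatio_le_F _ hx).trans (F_le_div_add (a := ((m + (k + 1) : ℕ) : ℝ) + 1 / 2)
      (by positivity) hx)).trans (le_of_eq ?_)
    congr 1; push_cast; ring

/-! ### Gaussian sums compared with Gaussian integrals. -/

/-- `exp (-y² / 2c)` times a lower bound for the Mills ratio: it is at most
`∫ exp (-s² / 2c)` over `(y, ∞)`. -/
noncomputable def millsLower (c y : ℝ) : ℝ :=
  Real.exp (-(y ^ 2 / (2 * c))) * (Real.sqrt (y ^ 2 + 4 * c) - y) / 2

theorem sqrt_sub_eq {c y : ℝ} (hc : 0 < c) (hy : 0 ≤ y) :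
    Real.sqrt (y ^ 2 + 4 * c) - y = 4 * c / (y + Real.sqrt (y ^ 2 + 4 * c)) := by
  have hs := Real.sq_sqrt (show 0 ≤ y ^ 2 + 4 * c by positivity)
  have : y + Real.sqrt (y ^ 2 + 4 * c) ≠ 0 := by positivity
  rw [eq_div_iff this]
  linarith

/-- The algebraic core of `millsLower_sub_le`, left once exp(-u) is replaced by 1 - u with u = (2y +
1)/(2c). -/
theorem sqrt_sub_step {c y : ℝ} (hc : 0 < c) (hy : 0 ≤ y) :
    Real.sqrt (y ^ 2 + 4 * c) - y -
      (1 - (2 * y + 1) / (2 * c)) * (Real.sqrt ((y + 1) ^ 2 + 4 * c) - (y + 1)) ≤ 2 := by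
  have h1 := sqrt_sub_eq hc (y := y + 1) (by positivity)
  have hs := Real.sq_sqrt (show 0 ≤ y ^ 2 + 4 * c by positivity)
  have hs' := Real.sq_sqrt (show 0 ≤ (y + 1) ^ 2 + 4 * c by positivity)
  have hle : Real.sqrt (y ^ 2 + 4 * c) ≤ Real.sqrt ((y + 1) ^ 2 + 4 * c) :=
    Real.sqrt_le_sqrt (by nlinarith)
  have hp : 0 < Real.sqrt (y ^ 2 + 4 * c) := by positivity
  have hp' : 0 < Real.sqrt ((y + 1) ^ 2 + 4 * c) := by positivity
  set s := Real.sqrt (y ^ 2 + 4 * c)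
  set s' := Real.sqrt ((y + 1) ^ 2 + 4 * c)
  have e1 : (2 * y + 1) / (2 * c) * (s' - (y + 1)) = (4 * y + 2) / (y + 1 + s') := by
    rw [h1]; field_simp; ring
  have e2 : (4 * y + 2) / (y + 1 + s') ≤ (4 * y + 2) / (y + 1 / 2 + s') := by
    apply div_le_div_of_nonneg_left (by positivity) (by positivity); linarith
  have e3 : (y + 1 / 2) / s' ≤ s' - s := by
    rw [div_le_iff₀ hp']; nlinarith
  have e4 : (4 * y + 2) / (y + 1 / 2 + s') - (y + 1 / 2) / s' ≤ 1 := by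
    rw [div_sub_div _ _ (by positivity) (by positivity), div_le_one (by positivity)]
    nlinarith [sq_nonneg (s' - (y + 1 / 2))]
  linarith

theorem millsLower_sub_le {c y : ℝ} (hc : 0 < c) (hy : 0 ≤ y) :
    millsLower c y - millsLower c (y + 1) ≤ Real.exp (-(y ^ 2 / (2 * c))) := by
  have hstep := sqrt_sub_step hc hy
  have hpos : 0 ≤ Real.sqrt ((y + 1) ^ 2 + 4 * c) - (y + 1) := by
    rw [sqrt_sub_eq hc (by positivity)]; positivity
  have hE : Real.exp (-((y + 1) ^ 2 / (2 * c))) =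
      Real.exp (-(y ^ 2 / (2 * c))) * Real.exp (-((2 * y + 1) / (2 * c))) := by
    rw [← Real.exp_add]; congr 1; field_simp; ring
  have hq := Real.one_sub_le_exp_neg ((2 * y + 1) / (2 * c))
  unfold millsLower
  rw [hE]
  have := mul_le_mul_of_nonneg_right hq hpos
  have h2 := mul_le_mul_of_nonneg_left (show Real.sqrt (y ^ 2 + 4 * c) - y -
      Real.exp (-((2 * y + 1) / (2 * c))) * (Real.sqrt ((y + 1) ^ 2 + 4 * c) - (y + 1)) ≤ 2
      by linarith) (Real.exp_nonneg (-(y ^ 2 / (2 * c))))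
  linarith

theorem millsLower_antitone {c y z : ℝ} (hc : 0 < c) (hy : 0 ≤ y) (hyz : y ≤ z) :
    millsLower c z ≤ millsLower c y := by
  unfold millsLower
  rw [sqrt_sub_eq hc hy, sqrt_sub_eq hc (hy.trans hyz)]
  have : 0 ≤ 4 * c / (z + Real.sqrt (z ^ 2 + 4 * c)) := by
    have := hy.trans hyz
    positivity
  gcongr

theorem millsLower_le_div {c y : ℝ} (hc : 0 < c) (hy : 0 < y) : millsLower c y ≤ c / y := by
  unfold millsLower
  rw [sqrt_sub_eq hc hy.le]
  have h1 : Real.exp (-(y ^ 2 / (2 * c))) ≤ 1 := Real.exp_le_one_iff.2 (by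
    rw [neg_nonpos]; positivity)
  have h2 : y ≤ Real.sqrt (y ^ 2 + 4 * c) := Real.le_sqrt_of_sq_le (by linarith)
  have h3 : 4 * c / (y + Real.sqrt (y ^ 2 + 4 * c)) ≤ 4 * c / (y + y) := by gcongr
  calc _ ≤ 1 * (4 * c / (y + y)) / 2 := by gcongr
    _ = c / y := by field_simp; ring

theorem sum_exp_le_gaussian {c : ℝ} (hc : 0 < c) (N : ℕ) :
    ∑ k ∈ Finset.range N, Real.exp (-(((k + 1 : ℕ) : ℝ) ^ 2 / (2 * c))) ≤
      Real.sqrt (2 * Real.pi * c) / 2 := by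
  have hanti : AntitoneOn (fun s : ℝ => Real.exp (-(s ^ 2 / (2 * c)))) (Set.Icc 0 (0 + (N : ℕ))) := by
    intro a ha b _ hab
    have := ha.1
    dsimp only
    gcongr
  have h1 := hanti.sum_le_integral
  simp only [zero_add] at h1
  refine h1.trans ?_
  have hb : (0 : ℝ) < 1 / (2 * c) := by positivity
  have e : ∀ s : ℝ, Real.exp (-(s ^ 2 / (2 * c))) = Real.exp (-(1 / (2 * c)) * s ^ 2) := by
    intro s; congr 1; ring
  simp only [e]
  have hI := integral_gaussian_Ioi (1 / (2 * c))
  rw [intervalIntegral.integral_of_le (by positivity)]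
  calc _ ≤ ∫ s in Set.Ioi (0 : ℝ), Real.exp (-(1 / (2 * c)) * s ^ 2) := by
        apply MeasureTheory.setIntegral_mono_set
        · exact (integrable_exp_neg_mul_sq hb).integrableOn
        · exact Filter.Eventually.of_forall fun s => Real.exp_nonneg _
        · exact (Set.Ioc_subset_Ioi_self).eventuallyLE
    _ = _ := by
        rw [hI]; congr 2; field_simp

theorem millsLower_sub_le_sum {c y : ℝ} (hc : 0 < c) (hy : 0 ≤ y) (N : ℕ) :
    millsLower c y - millsLower c (y + N) ≤
      ∑ k ∈ Finset.range N, Real.exp (-((y + k) ^ 2 / (2 * c))) := by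
  induction N with
  | zero => simp
  | succ N ih =>
    rw [Finset.sum_range_succ]
    have := millsLower_sub_le hc (y := y + N) (by positivity)
    push_cast
    rw [← add_assoc]
    linarith

/-- The sum of p + M terms is below the half-line integral. The last M of them telescope to at least
`millsLower` at p + 1, hence at x, up to an error c/(p + 1 + M) that vanishes as M grows. -/
theorem sum_exp_le_gaussian_sub {c x : ℝ} (hc : 0 < c) (p : ℕ) (hp : (p : ℝ) + 1 ≤ x) :
    ∑ k ∈ Finset.range p, Real.exp (-(((k + 1 : ℕ) : ℝ) ^ 2 / (2 * c))) ≤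
      Real.sqrt (2 * Real.pi * c) / 2 - millsLower c x := by
  have hM : ∀ M : ℕ, ∑ k ∈ Finset.range p, Real.exp (-(((k + 1 : ℕ) : ℝ) ^ 2 / (2 * c))) ≤
      Real.sqrt (2 * Real.pi * c) / 2 - millsLower c x + c / ((p : ℝ) + 1 + M) := by
    intro M
    have h1 := sum_exp_le_gaussian hc (p + M)
    rw [Finset.sum_range_add] at h1
    have h2 := millsLower_sub_le_sum hc (y := (p : ℝ) + 1) (by positivity) M
    have h3 := millsLower_antitone hc (by positivity) hp
    have h4 := millsLower_le_div hc (y := (p : ℝ) + 1 + M) (by positivity)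
    have e : ∀ k : ℕ, (((p + k + 1 : ℕ) : ℝ)) = (p : ℝ) + 1 + k := by
      intro k; push_cast; ring
    simp only [e] at h1
    linarith
  have hlim : Filter.Tendsto (fun M : ℕ => Real.sqrt (2 * Real.pi * c) / 2 - millsLower c x +
      c / ((p : ℝ) + 1 + M)) Filter.atTop (nhds (Real.sqrt (2 * Real.pi * c) / 2 - millsLower c x + 0)) :=
    tendsto_const_nhds.add (Filter.Tendsto.const_div_atTop
      (Filter.tendsto_atTop_add_const_left _ _ tendsto_natCast_atTop_atTop) c)
  rw [add_zero] at hlim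
  exact ge_of_tendsto' hlim hM

/-! ### Geometric tails and the upper bound for H(0, x). -/

theorem besselQuot_add_le_geometric (n k : ℕ) {x : ℝ} (hx : 0 < x) :
    besselQuot (n + k) x ≤ besselQuot n x * besselRatio n x ^ k := by
  induction k with
  | zero => simp
  | succ k ih =>
    rw [← add_assoc, besselQuot_succ _ hx, pow_succ, ← mul_assoc]
    exact mul_le_mul ih (besselRatio_antitone hx (Nat.le_add_right n k)) (besselRatio_pos _ hx).le
      ((besselQuot_pos _ hx).le.trans ih)

theorem besselRatio_lt_one (n : ℕ) {x : ℝ} (hx : 0 < x) : besselRatio n x < 1 :=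
  (besselRatio_le_F n hx).trans_lt (F_lt_one (by positivity) hx)

theorem summable_besselQuot_add (n : ℕ) {x : ℝ} (hx : 0 < x) :
    Summable fun k => besselQuot (n + k) x :=
  Summable.of_nonneg_of_le (fun _ => (besselQuot_pos _ hx).le)
    (fun k => besselQuot_add_le_geometric n k hx)
    ((summable_geometric_of_lt_one (besselRatio_pos n hx).le (besselRatio_lt_one n hx)).mul_left _)

theorem summable_besselQuot_succ {x : ℝ} (hx : 0 < x) :
    Summable fun k => besselQuot (k + 1) x := by
  simpa only [add_comm 1] using summable_besselQuot_add 1 hx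

theorem tsum_besselQuot_add_le (n : ℕ) {x : ℝ} (hx : 0 < x) :
    ∑' k, besselQuot (n + k) x ≤ besselQuot n x / (1 - besselRatio n x) := by
  have h := (hasSum_geometric_of_lt_one (besselRatio_pos n hx).le (besselRatio_lt_one n hx)).mul_left
    (besselQuot n x)
  rw [div_eq_mul_inv]
  exact hasSum_le (fun k => besselQuot_add_le_geometric n k hx)
    (summable_besselQuot_add n hx).hasSum h

theorem H_natCast (n : ℕ) {x : ℝ} (hx : 0 < x) :
    H n x = ∑' k, besselQuot (n + (k + 1)) x / besselQuot n x := by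
  have h0 := besselSeries_pos 0 (t := x / 2) (by positivity)
  unfold H besselQuot
  congr 1; ext k
  rw [show (n : ℝ) + ((k : ℝ) + 1) = ((n + (k + 1) : ℕ) : ℝ) by push_cast; ring,
    besselI_natCast, besselI_natCast, div_div_div_cancel_right₀ h0.ne']

theorem H_natCast_pos (n : ℕ) {x : ℝ} (hx : 0 < x) : 0 < H n x := by
  rw [H_natCast n hx]
  have hs := ((summable_nat_add_iff 1).2 (summable_besselQuot_add n hx)).div_const (besselQuot n x)
  exact hs.tsum_pos (fun k => (div_pos (besselQuot_pos _ hx) (besselQuot_pos _ hx)).le) 0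
    (div_pos (besselQuot_pos _ hx) (besselQuot_pos _ hx))

theorem H_zero {x : ℝ} (hx : 0 < x) : H 0 x = ∑' k, besselQuot (k + 1) x := by
  have := H_natCast 0 hx
  simpa [besselQuot_zero hx] using this

theorem H_zero_eq_add (p : ℕ) {x : ℝ} (hx : 0 < x) :
    H 0 x = ∑ k ∈ Finset.range p, besselQuot (k + 1) x + ∑' k, besselQuot (p + 1 + k) x := by
  rw [H_zero hx, ← (summable_besselQuot_succ hx).sum_add_tsum_nat_add p]
  congr 2; ext k; congr 1; ring

theorem tail_le (p : ℕ) {x : ℝ} (hx : 0 < x) :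
    ∑' k, besselQuot (p + 1 + k) x ≤
      besselQuot p x * (F (p + 1 / 2) x / (1 - F (p + 3 / 2) x)) := by
  refine (tsum_besselQuot_add_le (p + 1) hx).trans ?_
  rw [besselQuot_succ p hx, mul_div_assoc]
  have h1 := besselRatio_le_F p hx
  have h2 := besselRatio_le_F (p + 1) hx
  have e : (((p + 1 : ℕ) : ℝ)) + 1 / 2 = p + 3 / 2 := by push_cast; ring
  rw [e] at h2
  have h3 : F ((p : ℝ) + 3 / 2) x < 1 := F_lt_one (by positivity) hx
  refine mul_le_mul_of_nonneg_left ?_ (besselQuot_pos p hx).le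
  exact div_le_div₀ (F_pos (by positivity) hx).le h1 (by linarith) (by linarith)

theorem gaussUpper_zero_eq {x : ℝ} (hx : 0 < x) {p : ℕ} (hp : ⌊x⌋ = (p : ℤ) + 1) :
    gaussUpper 0 x = Real.sqrt (2 * Real.pi * (x / alpha0)) / 2 - millsLower (x / alpha0) x +
      Real.exp (-(alpha0 * (p : ℝ) ^ 2 / (2 * x))) *
        (F (p + 1 / 2) x / (1 - F (p + 3 / 2) x)) := by
  have ha := alpha0_pos
  have hc : 0 < x / alpha0 := by positivity
  have hfl : ((⌊x⌋ : ℤ) : ℝ) = (p : ℝ) + 1 := by rw [hp]; push_cast; rfl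
  have hpi := Real.pi_pos
  unfold gaussUpper millsLower
  rw [hfl, sqrt_sub_eq hc hx.le]
  simp only [Int.fract_zero, Int.floor_zero, Int.cast_zero]
  congr 1
  · rw [mul_sub]
    congr 1
    · rw [zero_add, zero_pow two_ne_zero, zero_add]
      have hA : Real.sqrt (8 * x / (Real.pi * alpha0)) ^ 2 = 8 * x / (Real.pi * alpha0) :=
        Real.sq_sqrt (by positivity)
      have hprod : Real.sqrt (8 * x / (Real.pi * alpha0)) * Real.sqrt (2 * Real.pi * (x / alpha0)) =
          4 * x / alpha0 := by
        rw [← Real.sqrt_mul (by positivity)]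
        rw [show 8 * x / (Real.pi * alpha0) * (2 * Real.pi * (x / alpha0)) = (4 * x / alpha0) ^ 2 by
          field_simp; ring]
        exact Real.sqrt_sq (by positivity)
      have hs : 0 < Real.sqrt (8 * x / (Real.pi * alpha0)) := by positivity
      rw [mul_one_div, div_eq_div_iff hs.ne' two_ne_zero]
      have : 2 * x / alpha0 * 2 = 4 * x / alpha0 := by ring
      rw [this, ← hprod, mul_comm]
    · have e1 : -(alpha0 / (2 * x)) * (x ^ 2 - 0 ^ 2) = -(x ^ 2 / (2 * (x / alpha0))) := by
        field_simp; ring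
      rw [e1, show 4 * (x / alpha0) = 4 * x / alpha0 by ring]
      ring
  · congr 2
    · field_simp; ring
    · congr 1; ring
    · congr 2; ring

theorem H_zero_le_upperBound {x : ℝ} (hx : 0 < x) : H 0 x ≤ upperBound 0 x := by
  unfold upperBound
  split_ifs with h
  · rw [Int.floor_zero, zero_add] at h
    -- With p = [x] - 1, the indices 1, ..., p form the Gaussian head and the geometric tail starts
    -- at [x].
    obtain ⟨p, hp⟩ : ∃ p : ℕ, ⌊x⌋ = (p : ℤ) + 1 := ⟨(⌊x⌋ - 1).toNat, by omega⟩
    have hpx : (p : ℝ) + 1 ≤ x := by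
      have := Int.floor_le x
      rw [hp] at this
      exact_mod_cast this
    rw [gaussUpper_zero_eq hx hp, H_zero_eq_add p hx]
    have hc : 0 < x / alpha0 := div_pos hx alpha0_pos
    refine add_le_add ((Finset.sum_le_sum fun k hk => ?_).trans (sum_exp_le_gaussian_sub hc p hpx))
      ((tail_le p hx).trans (mul_le_mul_of_nonneg_right
        (besselQuot_le_exp p hx (by linarith)) ?_))
    · have hkp : (k : ℝ) + 1 ≤ p := by exact_mod_cast Finset.mem_range.1 hk
      refine (besselQuot_le_exp (k + 1) hx (by push_cast; linarith)).trans (le_of_eq ?_)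
      have := alpha0_pos
      congr 2
      field_simp
    · have h1 : F ((p : ℝ) + 3 / 2) x < 1 := F_lt_one (by positivity) hx
      have h2 : 0 < F ((p : ℝ) + 1 / 2) x := F_pos (by positivity) hx
      exact (div_pos h2 (by linarith)).le
  · have := tail_le 0 hx
    rw [H_zero_eq_add 0 hx]
    simpa [besselQuot_zero hx] using this

/-! ### The lower bound for H(0, x). -/

/-- The Gaussian lower bound `exp (-k (k + 1) / 2x)` for `I_k(x) / I_0(x)`. -/
noncomputable def gaussTerm (x : ℝ) (k : ℕ) : ℝ := Real.exp (-((k : ℝ) * (k + 1) / (2 * x)))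

/-- `millsLower x (k + 1 / 2)`, normalized to be comparable with `gaussTerm x k`. -/
noncomputable def gaussTail (x : ℝ) (k : ℕ) : ℝ :=
  gaussTerm x k * (Real.sqrt (((k : ℝ) + 1 / 2) ^ 2 + 4 * x) - (k + 1 / 2)) / 2

theorem gaussTerm_pos (x : ℝ) (k : ℕ) : 0 < gaussTerm x k := Real.exp_pos _

/-- Completing the square, k(k + 1) = (k + 1/2)² - 1/4, produces the factor exp(1/(8x)). -/
theorem gaussTail_eq_millsLower {x : ℝ} (hx : 0 < x) (k : ℕ) :
    gaussTail x k = Real.exp (1 / (8 * x)) * millsLower x (k + 1 / 2) := by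
  have : gaussTerm x k = Real.exp (1 / (8 * x)) * Real.exp (-(((k : ℝ) + 1 / 2) ^ 2 / (2 * x))) := by
    rw [gaussTerm, ← Real.exp_add]; congr 1; field_simp; ring
  rw [gaussTail, millsLower, this]; ring

theorem gaussTail_sub_le {x : ℝ} (hx : 0 < x) (k : ℕ) :
    gaussTail x k - gaussTail x (k + 1) ≤ gaussTerm x k := by
  have h := millsLower_sub_le hx (y := (k : ℝ) + 1 / 2) (by positivity)
  have e : gaussTerm x k = Real.exp (1 / (8 * x)) * Real.exp (-(((k : ℝ) + 1 / 2) ^ 2 / (2 * x))) := by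
    rw [gaussTerm, ← Real.exp_add]; congr 1; field_simp; ring
  rw [gaussTail_eq_millsLower hx, gaussTail_eq_millsLower hx, e, ← mul_sub]
  refine mul_le_mul_of_nonneg_left ?_ (Real.exp_nonneg _)
  push_cast
  rwa [show (k : ℝ) + 1 + 1 / 2 = k + 1 / 2 + 1 by ring]

theorem gaussTail_nonneg {x : ℝ} (hx : 0 < x) (k : ℕ) : 0 ≤ gaussTail x k := by
  have := gaussTerm_pos x k
  rw [gaussTail, sqrt_sub_eq hx (by positivity)]
  positivity

theorem gaussTail_sub_le_sum {x : ℝ} (hx : 0 < x) (m N : ℕ) :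
    gaussTail x m - gaussTail x (m + N) ≤ ∑ k ∈ Finset.range N, gaussTerm x (m + k) := by
  induction N with
  | zero => simp
  | succ N ih =>
    rw [Finset.sum_range_succ, ← add_assoc]
    have := gaussTail_sub_le hx (m + N)
    linarith

/-- For rational a = n/b, raising to the power b leaves a comparison with a decimal bound for e. -/
theorem le_exp_neg_div {r : ℝ} (hr : 0 < r) (a : ℝ) (b n : ℕ) (hb : b ≠ 0) (ha : a * b = n)
    (h : r ^ b * 2.7182818286 ^ n ≤ 1) : r ≤ Real.exp (-a) := by
  rw [Real.exp_neg, le_inv_comm₀ hr (Real.exp_pos _)]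
  refine le_of_pow_le_pow_left₀ hb (by positivity) ?_
  rw [← Real.exp_nat_mul, mul_comm, ha, ← mul_one (n : ℝ), Real.exp_nat_mul, inv_pow, ← one_div,
    le_div_iff₀ (by positivity)]
  refine le_trans ?_ h
  rw [mul_comm]
  gcongr
  exact Real.exp_one_lt_d9.le

theorem exp_neg_div_le {r : ℝ} (hr : 0 < r) (a : ℝ) (b n : ℕ) (hb : b ≠ 0) (ha : a * b = n)
    (h : 1 ≤ r ^ b * 2.7182818283 ^ n) : Real.exp (-a) ≤ r := by
  rw [Real.exp_neg, inv_le_comm₀ (Real.exp_pos _) hr]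
  refine le_of_pow_le_pow_left₀ hb (by positivity) ?_
  rw [← Real.exp_nat_mul, mul_comm, ha, ← mul_one (n : ℝ), Real.exp_nat_mul, inv_pow,
    ← one_div, div_le_iff₀ (by positivity)]
  refine h.trans ?_
  rw [mul_comm]
  gcongr
  exact Real.exp_one_gt_d9.le

theorem gaussTerm_eq_mul {x : ℝ} (hx : 0 < x) {i j : ℕ} {a : ℝ}
    (h : (j : ℝ) * (j + 1) = i * (i + 1) + 2 * a) :
    gaussTerm x j = gaussTerm x i * Real.exp (-(a / x)) := by
  rw [gaussTerm, gaussTerm, ← Real.exp_add, h]; congr 1; field_simp; ring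

theorem sqrt_four_mul_le {a b x r : ℝ} (hr : 0 ≤ r) (hx : x ≤ b) (h : a ^ 2 + 4 * b ≤ r ^ 2) :
    Real.sqrt (a ^ 2 + 4 * x) ≤ r := by
  rw [Real.sqrt_le_left hr]; linarith

theorem le_sqrt_four_mul {a b x r : ℝ} (hx : b ≤ x) (h : r ^ 2 ≤ a ^ 2 + 4 * b) :
    r ≤ Real.sqrt (a ^ 2 + 4 * x) :=
  Real.le_sqrt_of_sq_le (by linarith)

theorem exp_neg_div_mono {a b x : ℝ} (ha : 0 ≤ a) (hb : 0 < b) (h : b ≤ x) :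
    Real.exp (-(a / b)) ≤ Real.exp (-(a / x)) := by gcongr

theorem gaussTail_sub_le_two {x : ℝ} (h2 : 2 ≤ x) (h3 : x < 3) :
    gaussTail x 1 - gaussTail x 3 ≤ gaussTerm x 1 + gaussTerm x 4 := by
  have hx : 0 < x := by linarith
  have hE := gaussTerm_pos x 1
  rw [gaussTail, gaussTail, gaussTerm_eq_mul hx (i := 1) (j := 3) (a := 5) (by norm_num),
    gaussTerm_eq_mul hx (i := 1) (j := 4) (a := 9) (by norm_num)]
  push_cast
  suffices h : (Real.sqrt ((1 + 1 / 2) ^ 2 + 4 * x) - (1 + 1 / 2)) / 2 -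
      Real.exp (-(5 / x)) * (Real.sqrt ((3 + 1 / 2) ^ 2 + 4 * x) - (3 + 1 / 2)) / 2 ≤
      1 + Real.exp (-(9 / x)) by
    nlinarith [mul_le_mul_of_nonneg_left h hE.le]
  have p5 := Real.exp_pos (-(5 / x))
  have p9 := Real.exp_pos (-(9 / x))
  -- The expression is monotone in each root and exponential, so rational bounds on the pieces [2,
  -- 5/2], [5/2, 11/4], [11/4, 3] suffice.
  have key : ∀ u v w z : ℝ, Real.sqrt ((1 + 1 / 2) ^ 2 + 4 * x) ≤ u →
      v ≤ Real.sqrt ((3 + 1 / 2) ^ 2 + 4 * x) → w ≤ Real.exp (-(5 / x)) →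
      z ≤ Real.exp (-(9 / x)) → 0 ≤ w → 7 / 2 ≤ v → (u - 3 / 2) / 2 - w * (v - 7 / 2) / 2 ≤ 1 + z →
      (Real.sqrt ((1 + 1 / 2) ^ 2 + 4 * x) - (1 + 1 / 2)) / 2 -
      Real.exp (-(5 / x)) * (Real.sqrt ((3 + 1 / 2) ^ 2 + 4 * x) - (3 + 1 / 2)) / 2 ≤
      1 + Real.exp (-(9 / x)) := by
    intro u v w z hu hv hw hz hw0 hv0 h
    have := mul_le_mul hw (sub_le_sub_right hv (7 / 2)) (by linarith) p5.le
    linarith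
  rcases le_total x (5 / 2) with h | h
  · exact key (7 / 2) (7 / 2) 0 0 (sqrt_four_mul_le (by norm_num) h (by norm_num))
      (le_sqrt_four_mul h2 (by norm_num)) p5.le p9.le le_rfl le_rfl (by norm_num)
  rcases le_total x (11 / 4) with h' | h'
  · exact key 3.6401 4.716 0.135 0 (sqrt_four_mul_le (by norm_num) h' (by norm_num))
      (le_sqrt_four_mul h (by norm_num))
      ((le_exp_neg_div (by norm_num) (5 / (5 / 2)) 1 2 (by norm_num) (by norm_num)
        (by norm_num)).trans (exp_neg_div_mono (by norm_num) (by norm_num) h))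
      p9.le (by norm_num) (by norm_num) (by norm_num)
  · exact key 3.775 4.82 0.16 0.037 (sqrt_four_mul_le (by norm_num) h3.le (by norm_num))
      (le_sqrt_four_mul h' (by norm_num))
      ((le_exp_neg_div (by norm_num) (5 / (11 / 4)) 11 20 (by norm_num) (by norm_num)
        (by norm_num)).trans (exp_neg_div_mono (by norm_num) (by norm_num) h'))
      ((le_exp_neg_div (by norm_num) (9 / (11 / 4)) 11 36 (by norm_num) (by norm_num)
        (by norm_num)).trans (exp_neg_div_mono (by norm_num) (by norm_num) h'))
      (by norm_num) (by norm_num) (by norm_num)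

theorem gaussTail_le_three {x : ℝ} (h3 : 3 ≤ x) (h4 : x < 4) :
    gaussTail x 1 ≤ gaussTerm x 1 + gaussTerm x 2 := by
  have hx : 0 < x := by linarith
  have hE := gaussTerm_pos x 1
  rw [gaussTail, gaussTerm_eq_mul hx (i := 1) (j := 2) (a := 2) (by norm_num)]
  push_cast
  have hs := sqrt_four_mul_le (a := 1 + 1 / 2) (r := 4.273) (by norm_num) h4.le (by norm_num)
  have he := (le_exp_neg_div (r := 0.5) (by norm_num) (2 / 3) 3 2 (by norm_num) (by norm_num)
        (by norm_num)).trans (exp_neg_div_mono (by norm_num) (by norm_num) h3)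
  have h : (Real.sqrt ((1 + 1 / 2) ^ 2 + 4 * x) - (1 + 1 / 2)) / 2 ≤ 1 + Real.exp (-(2 / x)) := by
    linarith
  linarith [mul_le_mul_of_nonneg_left h hE.le]

/-- The first telescoping step has slack; 0.166 of it later absorbs the surplus term of index p + 1
(see `gaussTerm_le`). -/
theorem gaussTail_one_sub_two_add_le {x : ℝ} (h4 : 4 ≤ x) :
    gaussTail x 1 - gaussTail x 2 + 0.166 * gaussTerm x 1 ≤ gaussTerm x 1 := by
  have hx : 0 < x := by linarith
  have hE := gaussTerm_pos x 1
  rw [gaussTail, gaussTail, gaussTerm_eq_mul hx (i := 1) (j := 2) (a := 2) (by norm_num)]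
  push_cast
  have hq := Real.one_sub_le_exp_neg (2 / x)
  have hs0 := le_sqrt_four_mul (a := 1 + 1 / 2) (r := 4.25) h4 (by norm_num)
  have hs0' := le_sqrt_four_mul (a := 2 + 1 / 2) (r := 4.7) h4 (by norm_num)
  have hs := Real.sq_sqrt (show 0 ≤ (1 + 1 / 2) ^ 2 + 4 * x by positivity)
  have hs' := Real.sq_sqrt (show 0 ≤ (2 + 1 / 2) ^ 2 + 4 * x by positivity)
  set s := Real.sqrt ((1 + 1 / 2) ^ 2 + 4 * x)
  set s' := Real.sqrt ((2 + 1 / 2) ^ 2 + 4 * x)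
  set q := Real.exp (-(2 / x))
  -- Since s'² - s² = 4, both roots and x are rational functions of p = s + s'.
  obtain ⟨p, hp⟩ : ∃ p, p = s + s' := ⟨_, rfl⟩
  have hp0 : 8.95 ≤ p := by linarith
  have hpp : 0 < p := by linarith
  have e1 : s' - s = 4 / p := by
    rw [eq_div_iff hpp.ne', hp]; linarith
  have e2 : s' + 5 / 2 = (p + 1) * (p + 4) / (2 * p) := by
    rw [eq_div_iff (by positivity)]
    have : 2 * s' = p + 4 / p := by linarith
    have h' : 2 * s' * p = p ^ 2 + 4 := by rw [this]; field_simp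
    linarith
  have e3 : 2 / x * (s' - 5 / 2) = 16 * p / ((p + 1) * (p + 4)) := by
    have h1 : (s' - 5 / 2) * (s' + 5 / 2) = 4 * x := by linarith
    have h2 : 2 / x * (s' - 5 / 2) = 8 / (s' + 5 / 2) := by
      rw [eq_div_iff (by linarith), mul_assoc, h1]; field_simp; norm_num
    rw [h2, e2]; field_simp; norm_num
  have e4 : 16 * p / ((p + 1) * (p + 4)) - 4 / p ≤ 0.668 := by
    rw [div_sub_div _ _ (by positivity) hpp.ne', div_le_iff₀ (by positivity)]
    obtain ⟨t, ht⟩ : ∃ t, p = 8.95 + t := ⟨p - 8.95, by ring⟩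
    have ht0 : 0 ≤ t := by linarith
    rw [ht]
    nlinarith [mul_nonneg ht0 ht0, mul_nonneg ht0 (mul_nonneg ht0 ht0)]
  have h : (s - (1 + 1 / 2)) / 2 - q * (s' - (2 + 1 / 2)) / 2 + 0.166 ≤ 1 := by
    have := mul_le_mul_of_nonneg_right hq (show 0 ≤ s' - 5 / 2 by linarith)
    norm_num at this ⊢
    linarith
  linarith [mul_le_mul_of_nonneg_left h hE.le]

theorem gaussTerm_le {x : ℝ} {p : ℕ} (hp : 3 ≤ p) (hx : 0 < x) (hpx : x < p + 2) :
    gaussTerm x (p + 1) ≤ 0.166 * gaussTerm x 1 := by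
  have hp' : (3 : ℝ) ≤ p := by exact_mod_cast hp
  rw [gaussTerm_eq_mul hx (i := 1) (j := p + 1) (a := (p : ℝ) * (p + 3) / 2)
    (by push_cast; ring), mul_comm]
  refine mul_le_mul_of_nonneg_right ?_ (gaussTerm_pos x 1).le
  -- p(p + 3)/(2(p + 2)) is at least its value 9/5 at p = 3, and exp(-9/5) < 0.166.
  refine le_trans (Real.exp_le_exp.2 (neg_le_neg ?_))
    (exp_neg_div_le (by norm_num) (9 / 5) 5 9 (by norm_num) (by norm_num) (by norm_num))
  rw [le_div_iff₀ hx]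
  nlinarith

/-- The left side is a discrete analogue of the Gaussian integral over `[1, p + 2]`, which has one
more unit of length than there are terms in the sum. -/
theorem gaussTail_sub_le_sum_add {x : ℝ} {p : ℕ} (hp : 1 ≤ p) (h1 : (p : ℝ) + 1 ≤ x)
    (h2 : x < p + 2) :
    gaussTail x 1 - gaussTail x (p + 2) ≤
      ∑ k ∈ Finset.range p, gaussTerm x (k + 1) + gaussTerm x (p + 3) := by
  have hx : 0 < x := by linarith [(Nat.cast_nonneg p : (0 : ℝ) ≤ p)]
  obtain rfl | rfl | hp3 : p = 1 ∨ p = 2 ∨ 3 ≤ p := by omega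
  · norm_num at h1 h2
    simpa using gaussTail_sub_le_two h1 h2
  · norm_num at h1 h2
    have := gaussTail_le_three h1 h2
    have h5 := gaussTerm_pos x 5
    have h6 := gaussTail_nonneg hx 4
    norm_num [Finset.sum_range_succ]
    linarith
  · have h4 : 4 ≤ x := by
      have : (3 : ℝ) ≤ p := by exact_mod_cast hp3
      linarith
    -- Telescoping from 1 to p + 2 uses the terms 1, ..., p + 1; the last is paid for by the slack
    -- of the first step.
    have a1 := gaussTail_one_sub_two_add_le h4
    have a2 := gaussTerm_le hp3 hx h2
    have a3 := gaussTail_sub_le hx (p + 1)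
    have a4 := gaussTail_sub_le_sum hx 2 (p - 1)
    have a5 := gaussTerm_pos x (p + 3)
    obtain ⟨m, rfl⟩ : ∃ m, p = m + 1 := ⟨p - 1, by omega⟩
    rw [Finset.sum_range_succ']
    simp only [Nat.add_sub_cancel, zero_add] at a4 ⊢
    have e : ∀ k, gaussTerm x (2 + k) = gaussTerm x (k + 1 + 1) := fun k => by congr 1; ring
    simp only [e] at a4
    rw [show 2 + m = m + 1 + 1 by ring] at a4
    rw [show m + 1 + 1 + 1 = m + 1 + 2 by ring] at a3
    linarith

theorem gaussLower_zero_eq {x : ℝ} {p : ℕ} (hp : ⌊x⌋ = (p : ℤ) + 1) :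
    gaussLower 0 x = 2 * x * gaussTerm x 1 / (3 / 2 + Real.sqrt ((3 / 2) ^ 2 + 4 * x)) -
      2 * x * gaussTerm x (p + 2) /
        (p + 5 / 2 + Real.sqrt ((p + 5 / 2) ^ 2 + 8 * x / Real.pi)) +
      gaussTerm x p * (F (p + 1) x * (1 + F (p + 2) x)) := by
  have hfl : ((⌊x⌋ : ℤ) : ℝ) = (p : ℝ) + 1 := by rw [hp]; push_cast; rfl
  unfold gaussLower gaussTerm
  rw [hfl]
  simp only [Int.fract_zero, Int.floor_zero, Int.cast_zero, zero_add, add_zero, sub_zero,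
    add_sub_cancel_right, Nat.cast_one]
  push_cast
  rw [show (p : ℝ) + 1 + 1 = p + 2 by ring, show (p : ℝ) + 1 + 3 / 2 = p + 5 / 2 by ring,
    show (p : ℝ) + 1 + 2 = p + 3 by ring, show (p : ℝ) + 2 + 1 = p + 3 by ring]
  congr 1
  · congr 1
    · congr 3; ring
    · congr 3; ring
  · congr 2; ring

theorem gaussTail_eq_div {x : ℝ} (hx : 0 < x) (k : ℕ) : gaussTail x k =
    2 * x * gaussTerm x k / (k + 1 / 2 + Real.sqrt (((k : ℝ) + 1 / 2) ^ 2 + 4 * x)) := by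
  rw [gaussTail, sqrt_sub_eq hx (by positivity)]; ring

theorem lowerBound_zero_le_H {x : ℝ} (hx : 0 < x) : lowerBound 0 x ≤ H 0 x := by
  unfold lowerBound
  split_ifs with h
  · rw [Int.floor_zero, zero_add] at h
    obtain ⟨p, hp⟩ : ∃ p : ℕ, ⌊x⌋ = (p : ℤ) + 1 := ⟨(⌊x⌋ - 1).toNat, by omega⟩
    have hp1 : 1 ≤ p := by omega
    have hpx : (p : ℝ) + 1 ≤ x := by
      have := Int.floor_le x
      rw [hp] at this
      exact_mod_cast this
    have hpx' : x < p + 2 := by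
      have := Int.lt_floor_add_one x
      rw [hp] at this
      push_cast at this
      linarith
    rw [gaussLower_zero_eq hp]
    have t1 : 2 * x * gaussTerm x 1 / (3 / 2 + Real.sqrt ((3 / 2) ^ 2 + 4 * x)) = gaussTail x 1 := by
      rw [gaussTail_eq_div hx]; norm_num
    have t2 : gaussTail x (p + 2) ≤ 2 * x * gaussTerm x (p + 2) /
        (p + 5 / 2 + Real.sqrt ((p + 5 / 2) ^ 2 + 8 * x / Real.pi)) := by
      have := gaussTerm_pos x (p + 2)
      have hpi := Real.pi_gt_three
      rw [gaussTail_eq_div hx, show (((p + 2 : ℕ) : ℝ)) + 1 / 2 = p + 5 / 2 by push_cast; ring]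
      have : 8 * x / Real.pi ≤ 4 * x := by
        rw [div_le_iff₀ Real.pi_pos]; nlinarith
      gcongr
    have key := gaussTail_sub_le_sum_add hp1 hpx hpx'
    -- Indices p + 1 and p + 2 supply the F-terms of the bound; index p + 3 supplies the extra
    -- `gaussTerm` of `key`.
    have hH : ∑ k ∈ Finset.range (p + 3), besselQuot (k + 1) x ≤ H 0 x := by
      rw [H_zero hx]
      exact (summable_besselQuot_succ hx).sum_le_tsum _ fun k _ => (besselQuot_pos _ hx).le
    simp only [Finset.sum_range_succ] at hH
    have hsum : ∑ k ∈ Finset.range p, gaussTerm x (k + 1) ≤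
        ∑ k ∈ Finset.range p, besselQuot (k + 1) x :=
      Finset.sum_le_sum fun k _ => exp_le_besselQuot (k + 1) hx
    have hF1 := F_le_besselRatio p hx
    have hF2 := F_le_besselRatio (p + 1) hx
    rw [show (((p + 1 : ℕ) : ℝ)) + 1 = p + 2 by push_cast; ring] at hF2
    have hf1 : 0 < F ((p : ℝ) + 1) x := F_pos (by positivity) hx
    have hf2 : 0 < F ((p : ℝ) + 2) x := F_pos (by positivity) hx
    have hq0 := exp_le_besselQuot p hx
    have hq1 : gaussTerm x p * F (p + 1) x ≤ besselQuot (p + 1) x := by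
      rw [besselQuot_succ p hx]
      exact mul_le_mul hq0 hF1 hf1.le (besselQuot_pos p hx).le
    have hq2 : gaussTerm x p * F (p + 1) x * F (p + 2) x ≤ besselQuot (p + 1 + 1) x := by
      rw [besselQuot_succ (p + 1) hx]
      exact mul_le_mul hq1 hF2 hf2.le (besselQuot_pos _ hx).le
    have hq3 : gaussTerm x (p + 3) ≤ besselQuot (p + 2 + 1) x := exp_le_besselQuot (p + 3) hx
    rw [t1, mul_add, mul_one, mul_add, ← mul_assoc]
    linarith
  · have hH : ∑ k ∈ Finset.range 2, besselQuot (k + 1) x ≤ H 0 x := by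
      rw [H_zero hx]
      exact (summable_besselQuot_succ hx).sum_le_tsum _ fun k _ => (besselQuot_pos _ hx).le
    have hF1 := F_le_besselRatio 0 hx
    have hF2 := F_le_besselRatio 1 hx
    have hf1 : 0 < F 1 x := F_pos (by norm_num) hx
    have hf2 : 0 < F 2 x := F_pos (by norm_num) hx
    norm_num at hF1 hF2
    rw [Finset.sum_range_succ, Finset.sum_range_one, besselQuot_succ 1 hx, zero_add,
      besselQuot_succ 0 hx, besselQuot_zero hx, one_mul] at hH
    norm_num
    nlinarith [mul_le_mul hF1 hF2 hf2.le (hf1.le.trans hF1)]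

/-- Keeps the denominator 1 + 2 L(0, x) positive when it replaces 1 + 2 H(0, x). -/
theorem lowerBound_zero_nonneg {x : ℝ} (hx : 0 < x) : 0 ≤ lowerBound 0 x := by
  unfold lowerBound
  split_ifs with h
  · rw [Int.floor_zero, zero_add] at h
    obtain ⟨p, hp⟩ : ∃ p : ℕ, ⌊x⌋ = (p : ℤ) + 1 := ⟨(⌊x⌋ - 1).toNat, by omega⟩
    have hpx' : x < p + 2 := by
      have := Int.lt_floor_add_one x
      rw [hp] at this
      push_cast at this
      linarith
    have hp1 : (1 : ℝ) ≤ p := by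
      have : 1 ≤ p := by omega
      exact_mod_cast this
    rw [gaussLower_zero_eq hp]
    have hf1 : 0 < F ((p : ℝ) + 1) x := F_pos (by positivity) hx
    have hf2 : 0 < F ((p : ℝ) + 2) x := F_pos (by positivity) hx
    have hg := gaussTerm_pos x p
    have hle : 2 * x * gaussTerm x (p + 2) /
        (p + 5 / 2 + Real.sqrt ((p + 5 / 2) ^ 2 + 8 * x / Real.pi)) ≤
        2 * x * gaussTerm x 1 / (3 / 2 + Real.sqrt ((3 / 2) ^ 2 + 4 * x)) := by
      have hpi := Real.pi_pos
      have hpi4 := Real.pi_le_four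
      have h8 : 2 * x ≤ 8 * x / Real.pi := by
        rw [le_div_iff₀ hpi]; nlinarith
      have hmono : gaussTerm x (p + 2) ≤ gaussTerm x 1 := by
        unfold gaussTerm
        push_cast
        gcongr <;> linarith
      have hsq : (3 / 2 : ℝ) ^ 2 + 4 * x ≤ (p + 5 / 2) ^ 2 + 8 * x / Real.pi := by nlinarith
      have := gaussTerm_pos x 1
      gcongr ?_ * ?_ / (?_ + Real.sqrt ?_)
      linarith
    have : 0 ≤ gaussTerm x p * (F (p + 1) x * (1 + F (p + 2) x)) := by positivity
    linarith
  · have hf1 : 0 < F (0 + 1) x := F_pos (by norm_num) hx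
    have hf2 : 0 < F (0 + 2) x := F_pos (by norm_num) hx
    positivity

/-! ### The Skellam law in terms of Bessel functions. -/

theorem hasSum_measureReal_iUnion {α : Type*} [MeasurableSpace α] (μ : MeasureTheory.Measure α)
    [MeasureTheory.IsFiniteMeasure μ] {f : ℕ → Set α} (hd : Pairwise (Function.onFun Disjoint f))
    (hm : ∀ i, MeasurableSet (f i)) : HasSum (fun i => μ.real (f i)) (μ.real (⋃ i, f i)) := by
  have h := MeasureTheory.measure_iUnion (μ := μ) hd hm
  have hne : ∑' i, μ (f i) ≠ ⊤ := h ▸ MeasureTheory.measure_ne_top μ _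
  have := ENNReal.hasSum_toReal hne
  rw [← ENNReal.tsum_toReal_eq fun i => MeasureTheory.measure_ne_top μ _, ← h] at this
  exact this

instance (l₁ l₂ : NNReal) : MeasureTheory.IsProbabilityMeasure (skellam l₁ l₂) :=
  MeasureTheory.Measure.isProbabilityMeasure_map Measurable.of_discrete.aemeasurable

theorem poisson_prod_real_singleton (l : NNReal) (i j : ℕ) :
    ((ProbabilityTheory.poissonMeasure l).prod (ProbabilityTheory.poissonMeasure l)).real {(i, j)} =
      Real.exp (-(2 * (l : ℝ))) * ((l : ℝ) ^ (i + j) / ((j.factorial : ℝ) * (i.factorial : ℝ))) := by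
  rw [← Set.singleton_prod_singleton, MeasureTheory.measureReal_prod_prod,
    ProbabilityTheory.poissonMeasure_real_singleton, ProbabilityTheory.poissonMeasure_real_singleton,
    show -(2 * (l : ℝ)) = -l + -l by ring, Real.exp_add, pow_add]
  field_simp

/-- The map e enumerates the diagonal i - j = z; leaving it abstract treats z = n and z = -n
together. -/
theorem skellam_real_singleton (l : NNReal) (n : ℕ) (z : ℤ) (e : ℕ → ℕ × ℕ)
    (he : Function.Injective e) (hz : ∀ p : ℕ × ℕ, (p.1 : ℤ) - p.2 = z ↔ ∃ k, e k = p)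
    (hterm : ∀ k, (l : ℝ) ^ ((e k).1 + (e k).2) / (((e k).2.factorial : ℝ) * (e k).1.factorial) =
      (l : ℝ) ^ (2 * k + n) / ((k.factorial : ℝ) * ((k + n).factorial : ℝ))) :
    (skellam l l).real {z} = Real.exp (-(2 * (l : ℝ))) * besselSeries n l := by
  have hset : (fun p : ℕ × ℕ => (p.1 : ℤ) - (p.2 : ℤ)) ⁻¹' {z} = ⋃ k : ℕ, {e k} := by
    ext p
    simp only [Set.mem_preimage, Set.mem_singleton_iff, Set.mem_iUnion, hz, eq_comm]
  unfold skellam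
  rw [MeasureTheory.map_measureReal_apply Measurable.of_discrete (measurableSet_singleton _), hset]
  have h := hasSum_measureReal_iUnion ((ProbabilityTheory.poissonMeasure l).prod
    (ProbabilityTheory.poissonMeasure l)) (f := fun k : ℕ => {e k})
    (fun i j hij => by simpa [Function.onFun] using fun h => hij (he h))
    (fun i => measurableSet_singleton _)
  rw [← h.tsum_eq, besselSeries, ← tsum_mul_left]
  congr 1; ext k
  rw [← hterm, ← poisson_prod_real_singleton]

theorem skellam_real_natCast (l : NNReal) (n : ℕ) :
    (skellam l l).real {(n : ℤ)} = Real.exp (-(2 * (l : ℝ))) * besselSeries n l :=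
  skellam_real_singleton l n n (fun k => (k + n, k)) (fun i j h => (Prod.mk.inj h).2)
    (fun ⟨i, j⟩ => ⟨fun h => ⟨j, Prod.ext (by dsimp only at h ⊢; omega) rfl⟩,
      fun ⟨k, hk⟩ => by rw [← hk]; dsimp only; push_cast; ring⟩)
    (fun k => by dsimp only; rw [show k + n + k = 2 * k + n by ring])

theorem skellam_real_neg_natCast (l : NNReal) (n : ℕ) :
    (skellam l l).real {-(n : ℤ)} = Real.exp (-(2 * (l : ℝ))) * besselSeries n l :=
  skellam_real_singleton l n (-n) (fun k => (k, k + n)) (fun i j h => (Prod.mk.inj h).1)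
    (fun ⟨i, j⟩ => ⟨fun h => ⟨i, Prod.ext rfl (by dsimp only at h ⊢; omega)⟩,
      fun ⟨k, hk⟩ => by rw [← hk]; dsimp only; push_cast; ring⟩)
    (fun k => by dsimp only; rw [show k + (k + n) = 2 * k + n by ring, mul_comm (k.factorial : ℝ)])

theorem hasSum_skellam_tail (l : NNReal) (n : ℕ) :
    HasSum (fun k : ℕ => 2 * (Real.exp (-(2 * (l : ℝ))) * besselSeries (n + (k + 1)) l))
      ((skellam l l).real {z : ℤ | (n : ℤ) < |z|}) := by
  have hset : {z : ℤ | (n : ℤ) < |z|} =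
      ⋃ k : ℕ, ({((n + (k + 1) : ℕ) : ℤ)} ∪ {-((n + (k + 1) : ℕ) : ℤ)}) := by
    ext z
    simp only [Set.mem_ofPred_eq, Set.mem_iUnion, Set.mem_union, Set.mem_singleton_iff]
    constructor
    · intro h
      refine ⟨(|z| - n - 1).toNat, ?_⟩
      rcases abs_cases z with h' | h' <;> omega
    · rintro ⟨k, h⟩
      rcases abs_cases z with h' | h' <;> omega
  have h := hasSum_measureReal_iUnion (skellam l l)
    (f := fun k : ℕ => {((n + (k + 1) : ℕ) : ℤ)} ∪ {-((n + (k + 1) : ℕ) : ℤ)})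
    (fun i j hij => by
      simp only [Function.onFun, Set.disjoint_left, Set.mem_union, Set.mem_singleton_iff]
      intro z hz hz'
      omega)
    (fun i => (measurableSet_singleton _).union (measurableSet_singleton _))
  rw [hset]
  convert h using 2 with k
  rw [MeasureTheory.measureReal_union (by
      rw [Set.disjoint_singleton]; omega) (measurableSet_singleton _),
    skellam_real_natCast, skellam_real_neg_natCast, two_mul]

theorem skellam_tail_eq {l : NNReal} (hl : 0 < l) (n : ℕ) :
    (skellam l l).real {z : ℤ | (n : ℤ) < |z|} =
      2 * (Real.exp (-(2 * (l : ℝ))) * besselSeries n l) * H n (2 * l) := by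
  have hl' : (0 : ℝ) < l := hl
  rw [← (hasSum_skellam_tail l n).tsum_eq, H_natCast n (by positivity), ← tsum_mul_left]
  congr 1; ext k
  have h0 := besselSeries_pos 0 hl'
  have h1 := besselSeries_pos n hl'
  unfold besselQuot
  rw [show 2 * (l : ℝ) / 2 = l by ring]
  field_simp

/-- Total mass one, split into W = 0 and |W| > 0. -/
theorem exp_mul_besselSeries_zero {l : NNReal} (hl : 0 < l) :
    Real.exp (-(2 * (l : ℝ))) * besselSeries 0 l * (1 + 2 * H 0 (2 * l)) = 1 := by
  have h1 : (skellam l l).real Set.univ = 1 := MeasureTheory.probReal_univ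
  have hset : (Set.univ : Set ℤ) = {((0 : ℕ) : ℤ)} ∪ {z : ℤ | ((0 : ℕ) : ℤ) < |z|} := by
    ext z
    simp [em]
  rw [hset, MeasureTheory.measureReal_union (by simp) MeasurableSet.of_discrete,
    skellam_real_natCast, skellam_tail_eq hl] at h1
  rw [Nat.cast_zero] at h1
  linarith

theorem skellam_tail_div_H {l : NNReal} (hl : 0 < l) (n : ℕ) :
    (skellam l l).real {z : ℤ | (n : ℤ) < |z|} / H n (2 * l) =
      2 * besselQuot n (2 * l) / (1 + 2 * H 0 (2 * l)) := by
  have hl' : (0 : ℝ) < 2 * l := by have : (0 : ℝ) < l := hl; positivity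
  have hH := H_natCast_pos n hl'
  have hH0 : 0 < H 0 (2 * l) := by simpa using H_natCast_pos 0 hl'
  have h := exp_mul_besselSeries_zero hl
  have h0 := besselSeries_pos 0 (t := l) hl
  rw [skellam_tail_eq hl, mul_div_cancel_right₀ _ hH.ne', eq_div_iff (by positivity), besselQuot,
    show 2 * (l : ℝ) / 2 = l by ring]
  field_simp
  linear_combination besselSeries n l * h

end SkellamBounds

/-! ### Assembly of the bounds. -/

theorem corollary2 {Ω : Type*} [MeasurableSpace Ω] (P : MeasureTheory.Measure Ω)
    [MeasureTheory.IsProbabilityMeasure P] (lam : NNReal) (hlam : 0 < lam) (W : Ω → ℤ)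
    (hW : ProbabilityTheory.HasLaw W (SkellamBounds.skellam lam lam) P) (ν : ℕ) :
    ((ν : ℝ) ≤ 2 * (lam : ℝ) →
      2 * Real.exp (-((ν : ℝ) * ((ν : ℝ) + 1) / (4 * (lam : ℝ)))) /
            (1 + 2 * SkellamBounds.upperBound 0 (2 * (lam : ℝ)))
          ≤ P.real {ω | (ν : ℤ) < |W ω|} / SkellamBounds.H (ν : ℝ) (2 * (lam : ℝ)) ∧
      P.real {ω | (ν : ℤ) < |W ω|} / SkellamBounds.H (ν : ℝ) (2 * (lam : ℝ))
          ≤ 2 * Real.exp (-(SkellamBounds.alpha0 / (4 * (lam : ℝ)) * (ν : ℝ) ^ 2)) /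
            (1 + 2 * SkellamBounds.lowerBound 0 (2 * (lam : ℝ)))) ∧
    (2 * (lam : ℝ) < (ν : ℝ) →
      2 * Real.exp (-((⌊2 * (lam : ℝ)⌋₊ : ℝ) * ((⌊2 * (lam : ℝ)⌋₊ : ℝ) + 1) /
                (4 * (lam : ℝ)))) *
              ProbabilityTheory.beta ((⌊2 * (lam : ℝ)⌋₊ : ℝ) + (lam : ℝ) + 1)
                ((ν : ℝ) - (⌊2 * (lam : ℝ)⌋₊ : ℝ)) *
              ((lam : ℝ) ^ (ν - ⌊2 * (lam : ℝ)⌋₊) /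
                ((ν - ⌊2 * (lam : ℝ)⌋₊ - 1).factorial : ℝ)) /
            (1 + 2 * SkellamBounds.upperBound 0 (2 * (lam : ℝ)))
          ≤ P.real {ω | (ν : ℤ) < |W ω|} / SkellamBounds.H (ν : ℝ) (2 * (lam : ℝ)) ∧
      P.real {ω | (ν : ℤ) < |W ω|} / SkellamBounds.H (ν : ℝ) (2 * (lam : ℝ))
          ≤ 2 * Real.exp (-(SkellamBounds.alpha0 / (4 * (lam : ℝ)) *
                (⌊2 * (lam : ℝ)⌋₊ : ℝ) ^ 2)) *
              ProbabilityTheory.beta ((⌊2 * (lam : ℝ)⌋₊ : ℝ) + 2 * (lam : ℝ) + 1 / 2)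
                ((ν : ℝ) - (⌊2 * (lam : ℝ)⌋₊ : ℝ)) *
              ((2 * (lam : ℝ)) ^ (ν - ⌊2 * (lam : ℝ)⌋₊) /
                ((ν - ⌊2 * (lam : ℝ)⌋₊ - 1).factorial : ℝ)) /
            (1 + 2 * SkellamBounds.lowerBound 0 (2 * (lam : ℝ)))) := by
  open SkellamBounds in
  have hl : (0 : ℝ) < lam := hlam
  have hx : (0 : ℝ) < 2 * lam := by positivity
  have hL0 := lowerBound_zero_nonneg hx
  have hL := lowerBound_zero_le_H hx
  have hU := H_zero_le_upperBound hx
  have hlaw : P.real {ω | (ν : ℤ) < |W ω|} = (skellam lam lam).real {z : ℤ | (ν : ℤ) < |z|} :=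
    hW.measureReal_eq (p := fun z => (ν : ℤ) < |z|) MeasurableSet.of_discrete
  rw [hlaw, skellam_tail_div_H hlam]
  have exp_lower (n : ℕ) :
      Real.exp (-((n : ℝ) * ((n : ℝ) + 1) / (4 * (lam : ℝ)))) ≤ besselQuot n (2 * lam) := by
    refine le_trans (le_of_eq ?_) (exp_le_besselQuot n hx)
    congr 3; ring
  have exp_upper (n : ℕ) (hn : (n : ℝ) ≤ 2 * lam) :
      besselQuot n (2 * lam) ≤ Real.exp (-(alpha0 / (4 * (lam : ℝ)) * (n : ℝ) ^ 2)) := by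
    refine (besselQuot_le_exp n hx hn).trans (le_of_eq ?_)
    congr 2; field_simp; ring
  have lower {a : ℝ} (h : a ≤ besselQuot ν (2 * lam)) :
      2 * a / (1 + 2 * upperBound 0 (2 * lam)) ≤
        2 * besselQuot ν (2 * lam) / (1 + 2 * H 0 (2 * lam)) :=
    div_le_div₀ (mul_nonneg two_pos.le (besselQuot_pos ν hx).le) (by linarith) (by linarith)
      (by linarith)
  have upper {a : ℝ} (h : besselQuot ν (2 * lam) ≤ a) :
      2 * besselQuot ν (2 * lam) / (1 + 2 * H 0 (2 * lam)) ≤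
        2 * a / (1 + 2 * lowerBound 0 (2 * lam)) :=
    div_le_div₀ (mul_nonneg two_pos.le ((besselQuot_pos ν hx).le.trans h)) (by linarith)
      (by linarith) (by linarith)
  refine ⟨fun hν => ⟨lower (exp_lower ν), upper (exp_upper ν hν)⟩, fun hν => ?_⟩
  have hm : (⌊2 * (lam : ℝ)⌋₊ : ℝ) ≤ 2 * lam := Nat.floor_le hx.le
  have hmν : ⌊2 * (lam : ℝ)⌋₊ < ν := (Nat.floor_lt hx.le).2 hν
  set m := ⌊2 * (lam : ℝ)⌋₊
  -- I_ν / I_0 is split at m = [2λ]: Gaussian bounds up to m, Beta products for the remaining k + 1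
  -- = ν - m ratios.
  obtain ⟨k, rfl⟩ : ∃ k, ν = m + (k + 1) := ⟨ν - m - 1, by omega⟩
  have e1 : ((m + (k + 1) : ℕ) : ℝ) - m = k + 1 := by push_cast; ring
  rw [e1, Nat.add_sub_cancel_left, Nat.add_sub_cancel]
  have hB1 : 0 ≤ ProbabilityTheory.beta ((m : ℝ) + lam + 1) ((k : ℝ) + 1) *
      ((lam : ℝ) ^ (k + 1) / (k.factorial : ℝ)) :=
    mul_nonneg (ProbabilityTheory.beta_pos (by positivity) (by positivity)).le (by positivity)
  have hB2 : 0 ≤ ProbabilityTheory.beta ((m : ℝ) + 2 * lam + 1 / 2) ((k : ℝ) + 1) *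
      ((2 * (lam : ℝ)) ^ (k + 1) / (k.factorial : ℝ)) :=
    mul_nonneg (ProbabilityTheory.beta_pos (by positivity) (by positivity)).le (by positivity)
  have h1 := le_besselQuot_add m k hx
  have h2 := besselQuot_add_le m k hx
  rw [show 2 * (lam : ℝ) / 2 = lam by ring] at h1
  constructor
  · rw [mul_assoc, mul_assoc]
    exact lower ((mul_le_mul_of_nonneg_right (exp_lower m) hB1).trans h1)
  · rw [mul_assoc, mul_assoc 2]
    exact upper (h2.trans (mul_le_mul_of_nonneg_right (exp_upper m hm) hB2))
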